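/- **Conventions.** All graphs are countable, connected, locally finite and simple. Let $\mathcal G_\bullet$ be the set of isomorphism classes of rooted graphs $(G,\rho)$, with the Borel $\sigma$-algebra of the distance $$d_{\mathrm{loc}}\big((G_1,\rho_1),(G_2,\rho_2)\big)=\inf\Big\{\tfrac1{r+1}: r\ge 0,\ (B_{G_1}(\rho_1,r),\rho_1)\simeq(B_{G_2}(\rho_2,r),\rho_2)\Big\},$$ where $B_G(\rho,r)$ is the subgraph spanned by the vertices at distance at most $r$ from $\rho$ and $\simeq$ is isomorphism of rooted graphs. A random rooted graph is a random variable $(G,\rho)$ with values in $\mathcal G_\bullet$. Conditionally on $(G,\rho)$ let $(X_n)_{n\ge0}$ be the simple random walk on $G$ with $X_0=\rho$, and let $P^G_\rho$ be its law (on the one-vertex graph the walk stays put). The random graph $(G,\rho)$ is *stationary* if $(G,X_n)$ has the same distribution as $(G,\rho)$ for all $n\ge1$. With $\varphi(t)=-t\log t$, $\varphi(0)=0$, put $$H_n(G,\rho)=\sum_{x\in V(G)}\varphi\big(P^G_\rho(X_n=x)\big),\qquad h_n=\mathbf E\big[H_n(G,\rho)\big]\in[0,\infty],\qquad h=\limsup_{n\to\infty}\frac{h_n}{n}\in[0,\infty].$$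 The tail $\sigma$-algebra is $\mathcal F^\infty(G,\rho)=\bigcap_{n\ge0}\sigma(X_n,X_{n+1},\dots)$; it is *trivial* if each of its events has $P^G_\rho$-probability $0$ or $1$. A graph is *Liouville* if every bounded harmonic function $f:V(G)\to\mathbb R$ is constant, where $f$ is harmonic if its value at each vertex is the average of its values at the neighbors. **Theorem.** Let $(G,\rho)$ be a stationary random graph with $h<\infty$. Then: 1. $h_n/n$ converges to $h$ as $n\to\infty$ ($h$ is called the mean entropy of $(G,\rho)$); 2. the tail $\sigma$-algebra $\mathcal F^\infty(G,\rho)$ of the simple random walk on $G$ started from $\rho$ is almost surely trivial if and only if $h=0$; 3. if $\mathcal F^\infty(G,\rho)$ is almost surely trivial, then $G$ is almost surely Liouville. -/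

import Mathlib

open MeasureTheory ProbabilityTheory Filter Topology
open scoped ENNReal

noncomputable section

namespace StatGraph

/-- A rooted graph: a countable, connected, locally finite simple graph together with a
distinguished vertex. -/
structure RootedGraph : Type 1 where
  /-- the vertex set -/
  V : Type
  /-- the edges -/
  graph : SimpleGraph V
  /-- the root vertex -/
  root : V
  countable : Countable V
  connected : graph.Connected
  finite_neighborSet : ∀ x, (graph.neighborSet x).Finite

namespace RootedGraph

/-- The vertex set is countable and carries the discrete σ-algebra. -/
instance (g : RootedGraph) : MeasurableSpace g.V := ⊤

instance (g : RootedGraph) : DiscreteMeasurableSpace g.V := ⟨fun _ => trivial⟩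

instance (g : RootedGraph) : Countable g.V := g.countable

/-- The neighbors of a vertex, as a finite set. -/
def nbrs (g : RootedGraph) (x : g.V) : Finset g.V := (g.finite_neighborSet x).toFinset

/-- The degree of a vertex. -/
def deg (g : RootedGraph) (x : g.V) : ℕ := (g.nbrs x).card

/-- The same graph with another root. -/
def reroot (g : RootedGraph) (x : g.V) : RootedGraph := { g with root := x }

/-- Isomorphism of rooted graphs: a graph isomorphism that maps root to root. -/
def Iso (g h : RootedGraph) : Prop := ∃ e : g.graph ≃g h.graph, e g.root = h.root

/-- The vertices at graph distance at most `r` from the root. -/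
def ballSet (g : RootedGraph) (r : ℕ) : Set g.V := {x | g.graph.dist g.root x ≤ r}

lemma root_mem_ballSet (g : RootedGraph) (r : ℕ) : g.root ∈ g.ballSet r := by
  simp [ballSet]

/-- The balls of radius `r` around the roots (the induced subgraphs on the vertices at distance
at most `r`) are isomorphic as rooted graphs. -/
def BallIso (g h : RootedGraph) (r : ℕ) : Prop :=
  ∃ e : g.graph.induce (g.ballSet r) ≃g h.graph.induce (h.ballSet r),
    e ⟨g.root, g.root_mem_ballSet r⟩ = ⟨h.root, h.root_mem_ballSet r⟩

instance setoid : Setoid RootedGraph where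
  r := Iso
  iseqv :=
    { refl := fun _ => ⟨SimpleGraph.Iso.refl, rfl⟩
      symm := by
        rintro g h ⟨e, he⟩
        exact ⟨e.symm, by rw [← he]; exact e.symm_apply_apply _⟩
      trans := by
        rintro g h k ⟨e, he⟩ ⟨f, hf⟩
        exact ⟨e.trans f, by rw [← hf, ← he]; rfl⟩ }

/-! ### Simple random walk -/

open Classical in
/-- One step of simple random walk from `x`: uniform over the neighbors of `x`. A vertex without
neighbors occurs only in the one-vertex graph, and there the walk stays where it is. -/
def stepMeasure (g : RootedGraph) (x : g.V) : Measure g.V :=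
  if (g.graph.neighborSet x).Nonempty then uniformOn (g.graph.neighborSet x) else Measure.dirac x

instance (g : RootedGraph) (x : g.V) : IsProbabilityMeasure (g.stepMeasure x) := by
  unfold stepMeasure
  split_ifs with h
  · exact isProbabilityMeasure_uniformOn (g.finite_neighborSet x) h
  · infer_instance

/-- The transition kernel of simple random walk. -/
def stepKernel (g : RootedGraph) : Kernel g.V g.V := ⟨g.stepMeasure, measurable_from_top⟩

instance (g : RootedGraph) : IsMarkovKernel g.stepKernel :=
  ⟨fun x => inferInstanceAs (IsProbabilityMeasure (g.stepMeasure x))⟩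

/-- The step from time `n` to time `n + 1`, given the path up to time `n`: it depends on the
position at time `n` only. -/
def pathKernel (g : RootedGraph) (n : ℕ) : Kernel (Finset.Iic n → g.V) g.V :=
  g.stepKernel.comap (fun w => w ⟨n, Finset.mem_Iic.2 le_rfl⟩) (measurable_pi_apply _)

instance (g : RootedGraph) (n : ℕ) : IsMarkovKernel (g.pathKernel n) := by
  unfold pathKernel; infer_instance

/-- The law, on the space of paths `ℕ → V`, of simple random walk started at the root. -/
def walkLaw (g : RootedGraph) : Measure (ℕ → g.V) :=
  Kernel.traj (X := fun _ => g.V) g.pathKernel 0 (fun _ => g.root)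

/-- The entropy of the position at time `n` of simple random walk started at the root: the sum
over `x` of `φ (P (X n = x))`, where `φ t = - t log t`. -/
def entropy (g : RootedGraph) (n : ℕ) : ℝ≥0∞ :=
  ∑' x : g.V, ENNReal.ofReal (Real.negMulLog (g.walkLaw.real {w | w n = x}))

/-- The tail σ-algebra on the path space: the intersection over `n` of the σ-algebras generated
by the coordinates `X n, X (n + 1), …`. -/
abbrev tailSigma (g : RootedGraph) : MeasurableSpace (ℕ → g.V) :=
  ⨅ n : ℕ, ⨆ k : ℕ, ⨆ _ : n ≤ k, MeasurableSpace.comap (fun w : ℕ → g.V => w k) inferInstance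

/-- Every tail event of simple random walk from the root has probability `0` or `1`. -/
def TailTrivial (g : RootedGraph) : Prop :=
  ∀ A : Set (ℕ → g.V), MeasurableSet[g.tailSigma] A → g.walkLaw A = 0 ∨ g.walkLaw A = 1

/-! ### Harmonic functions -/

/-- `f` is harmonic: its value at each vertex is the average of its values at the neighbors. -/
def Harmonic (g : RootedGraph) (f : g.V → ℝ) : Prop :=
  ∀ x, f x = (∑ y ∈ g.nbrs x, f y) / g.deg x

/-- There is no non-constant bounded harmonic function. -/
def Liouville (g : RootedGraph) : Prop :=
  ∀ f : g.V → ℝ, g.Harmonic f → (∃ C : ℝ, ∀ x, |f x| ≤ C) → ∀ x y, f x = f y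

end RootedGraph

/-- The space of isomorphism classes of rooted graphs. -/
abbrev RootedGraphClass : Type 1 := Quotient RootedGraph.setoid

namespace RootedGraphClass

/-- A representative of each class, chosen once and for all. -/
abbrev rep (c : RootedGraphClass) : RootedGraph := Quotient.out c

/-- The local distance: the infimum of `1 / (r + 1)` over the `r ≥ 0` such that the balls of
radius `r` around the roots are isomorphic. -/
def dloc (c d : RootedGraphClass) : ℝ :=
  sInf {t : ℝ | ∃ r : ℕ, t = 1 / ((r : ℝ) + 1) ∧ c.rep.BallIso d.rep r}

/-- The topology of the local distance, generated by its open balls. -/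
instance : TopologicalSpace RootedGraphClass :=
  TopologicalSpace.generateFrom
    {U | ∃ (c : RootedGraphClass) (ε : ℝ), 0 < ε ∧ U = {d | dloc c d < ε}}

instance : MeasurableSpace RootedGraphClass := borel _

instance : BorelSpace RootedGraphClass := ⟨rfl⟩

end RootedGraphClass

/-- The law `P` of a random rooted graph `(G, ρ)` is stationary: for every `n ≥ 1`, if given
`(G, ρ)` the sequence `X` is simple random walk on `G` from `ρ`, then `(G, X n)` has law `P`. -/
def Stationary (P : Measure RootedGraphClass) : Prop :=
  ∀ n : ℕ, 1 ≤ n → ∀ A : Set RootedGraphClass, MeasurableSet A →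
    ∫⁻ c, c.rep.walkLaw {w | (⟦c.rep.reroot (w n)⟧ : RootedGraphClass) ∈ A} ∂P = P A

/-- `h n`, the expected entropy of the walk at time `n`. -/
def meanEntropyAt (P : Measure RootedGraphClass) (n : ℕ) : ℝ≥0∞ :=
  ∫⁻ c, c.rep.entropy n ∂P

/-- The mean entropy `h = lim h n / n`, in `[0, ∞]`. It is written as an upper limit, so that
it is defined for every `P`. -/
def meanEntropy (P : Measure RootedGraphClass) : ℝ≥0∞ :=
  limsup (fun n : ℕ => meanEntropyAt P n / (n : ℝ≥0∞)) atTop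

end StatGraph

end

/-!
The proof follows Kaimanovich and Vershik: the entropy of the walk is compared with the information
that its position at a late time carries about its position at an early time.

Write `I k m` for the mutual information of `X k` and `X (k + m)` on a fixed graph. The chain rule
for entropy says that `H (k + m)` is `I k m` plus the mean of `H m` over the graphs rerooted at
`X k`. In a stationary random graph the latter has mean `h m`, so that
`h (k + m) = h m + E (I k m)` (`meanEntropyAt_add`). By the data-processing inequality `I k m`
decreases in `m`; hence the increments of `h` decrease, `h n / n` converges, and its limit is
`inf E (I 1 m)`, which is also the mean of `inf I 1 m` (`tendsto_meanEntropyAt_div`,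
`meanEntropy_eq_iInf`).

On a fixed graph, the tail is trivial if and only if `I k m` tends to `0` as `m → ∞` for every `k`.
In one direction, `I k m` is an average of the Kullback–Leibler divergences `condDiv k m x` of the
law of `X (k + m)` given `X k = x` from the unconditional law, and these control total variation by
a form of Pinsker's inequality; if they vanish in the limit, then tail events are independent of
every finite stretch of the path, hence of themselves (`tailTrivial_of_tendsto_condDiv`). In the
other direction, the likelihood ratios of these two laws, evaluated along the path, form a reverse
martingale that is bounded, so it converges in `L²` to a tail-measurable function of mean `1`. If
the tail is trivial then this function is `1`, so the chi-square divergence tends to `0`, and it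
dominates `condDiv` (`tendsto_condDiv_of_tailTrivial`). The same convergence in total variation
gives the Liouville property, as a bounded harmonic function is the mean of its values along the
walk (`liouville_of_tailTrivial`).

Measurability and stationarity are only needed for local functions, those determined by a ball of
fixed radius around the root. Their level sets are open (`IsLocal.isOpen_preimage`), and entropies
and mutual informations at fixed times are local.
-/

noncomputable section

namespace StatGraph

namespace RootedGraph

variable (g : RootedGraph)

/-! ### The averaging operator and transition probabilities -/

/-- The vertices to which simple random walk can step from `x`: the neighbors of `x`, or `x`
itself if it has none. -/
def succs (x : g.V) : Finset g.V :=
  open Classical in if (g.nbrs x).Nonempty then g.nbrs x else {x}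

/-- The transition operator of simple random walk on functions; its `n`-th iterate at `x` is the
expectation of `f (X n)` for the walk from `x`. -/
def avg (f : g.V → ℝ) (x : g.V) : ℝ := (∑ y ∈ g.succs x, f y) / (g.succs x).card

/-- The `n`-step transition probability from `x` to `y`. -/
def tp (n : ℕ) (x y : g.V) : ℝ := g.avg^[n] (Set.indicator {y} 1) x

open Classical in
/-- The vertices that simple random walk from `x` can occupy at time `n`. -/
def reach : ℕ → g.V → Finset g.V
  | 0, x => {x}
  | n + 1, x => (g.succs x).biUnion (reach n)

lemma succs_nonempty (x : g.V) : (g.succs x).Nonempty := by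
  classical
  unfold succs
  split_ifs with h
  · exact h
  · exact Finset.singleton_nonempty x

lemma card_succs_pos (x : g.V) : (0 : ℝ) < (g.succs x).card := by
  exact_mod_cast (g.succs_nonempty x).card_pos

lemma avg_mono {f f' : g.V → ℝ} (h : f ≤ f') : g.avg f ≤ g.avg f' := fun x =>
  div_le_div_of_nonneg_right (Finset.sum_le_sum fun y _ => h y) (g.card_succs_pos x).le

lemma avg_const (c : ℝ) : g.avg (fun _ => c) = fun _ => c := by
  funext x
  have := g.card_succs_pos x
  simp only [avg, Finset.sum_const, nsmul_eq_mul]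
  field_simp

lemma iterate_avg_const (n : ℕ) (c : ℝ) : g.avg^[n] (fun _ => c) = fun _ => c :=
  Function.iterate_fixed (g.avg_const c) n

lemma iterate_avg_nonneg (n : ℕ) {f : g.V → ℝ} (hf : 0 ≤ f) : 0 ≤ g.avg^[n] f := by
  have h : Monotone g.avg := fun _ _ h => g.avg_mono h
  have := h.iterate n hf
  rwa [show (0 : g.V → ℝ) = fun _ => (0 : ℝ) from rfl, iterate_avg_const] at this

lemma tp_nonneg (n : ℕ) (x y : g.V) : 0 ≤ g.tp n x y :=
  g.iterate_avg_nonneg n (Set.indicator_nonneg fun _ _ => zero_le_one) x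

lemma tp_succ (n : ℕ) (x y : g.V) :
    g.tp (n + 1) x y = (∑ z ∈ g.succs x, g.tp n z y) / (g.succs x).card := by
  rw [tp, Function.iterate_succ_apply']
  rfl

lemma tp_zero (x y : g.V) : g.tp 0 x y = Set.indicator {y} 1 x := rfl

lemma tp_pos_iff {n : ℕ} {x y : g.V} : 0 < g.tp n x y ↔ y ∈ g.reach n x := by
  classical
  induction n generalizing x with
  | zero =>
    rw [tp_zero, reach, Finset.mem_singleton, Set.indicator_apply]
    by_cases h : x = y
    · simp [h]
    · simp [h, Ne.symm h]
  | succ n ih =>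
    rw [tp_succ, reach, Finset.mem_biUnion, div_pos_iff_of_pos_right (g.card_succs_pos x),
      Finset.sum_pos_iff_of_nonneg fun z _ => g.tp_nonneg n z y]
    simp [ih]

lemma tp_eq_zero {n : ℕ} {x y : g.V} (h : y ∉ g.reach n x) : g.tp n x y = 0 :=
  le_antisymm (not_lt.1 fun h' => h (g.tp_pos_iff.1 h')) (g.tp_nonneg n x y)

lemma iterate_avg_eq_sum_of_subset (n : ℕ) (f : g.V → ℝ) (x : g.V) {s : Finset g.V}
    (hs : g.reach n x ⊆ s) : g.avg^[n] f x = ∑ y ∈ s, g.tp n x y * f y := by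
  classical
  induction n generalizing x s with
  | zero =>
    have hx : x ∈ s := hs (by simp [reach])
    rw [Finset.sum_eq_single_of_mem x hx]
    · simp [tp_zero]
    · intro y _ hy
      simp [tp_zero, Ne.symm hy]
  | succ n ih =>
    have h : ∀ z ∈ g.succs x, g.avg^[n] f z = ∑ y ∈ s, g.tp n z y * f y := fun z hz =>
      ih z ((Finset.subset_biUnion_of_mem (g.reach n) hz).trans hs)
    rw [Function.iterate_succ_apply', avg, Finset.sum_congr rfl h, Finset.sum_comm,
      Finset.sum_div]
    refine Finset.sum_congr rfl fun y _ => ?_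
    rw [tp_succ, ← Finset.sum_mul, div_mul_eq_mul_div]

lemma iterate_avg_eq_sum (n : ℕ) (f : g.V → ℝ) (x : g.V) :
    g.avg^[n] f x = ∑ y ∈ g.reach n x, g.tp n x y * f y :=
  g.iterate_avg_eq_sum_of_subset n f x subset_rfl

lemma sum_tp_of_subset (n : ℕ) (x : g.V) {s : Finset g.V} (hs : g.reach n x ⊆ s) :
    ∑ y ∈ s, g.tp n x y = 1 := by
  have := g.iterate_avg_eq_sum_of_subset n (fun _ => 1) x hs
  rw [iterate_avg_const] at this
  simpa using this.symm

/-- The Chapman–Kolmogorov equation. -/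
lemma tp_add (m n : ℕ) (x z : g.V) :
    g.tp (m + n) x z = ∑ y ∈ g.reach m x, g.tp m x y * g.tp n y z := by
  rw [tp, Function.iterate_add_apply, iterate_avg_eq_sum]
  rfl

lemma mem_reach_add {m n : ℕ} {x y z : g.V} (hy : y ∈ g.reach m x) (hz : z ∈ g.reach n y) :
    z ∈ g.reach (m + n) x := by
  rw [← tp_pos_iff, tp_add]
  refine Finset.sum_pos' (fun _ _ => mul_nonneg (g.tp_nonneg ..) (g.tp_nonneg ..)) ⟨y, hy, ?_⟩
  exact mul_pos (g.tp_pos_iff.2 hy) (g.tp_pos_iff.2 hz)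

lemma reach_subset_reach_add {m n : ℕ} {x y : g.V} (hy : y ∈ g.reach m x) :
    g.reach n y ⊆ g.reach (m + n) x := fun _ hz => g.mem_reach_add hy hz

/-! ### The law of the walk -/

/-- The law of simple random walk started from `x`. -/
def walkFrom (x : g.V) : Measure (ℕ → g.V) :=
  Kernel.traj (X := fun _ => g.V) g.pathKernel 0 (fun _ => x)

lemma walkLaw_eq : g.walkLaw = g.walkFrom g.root := rfl

instance (x : g.V) : IsProbabilityMeasure (g.walkFrom x) := by
  unfold walkFrom; infer_instance

lemma stepMeasure_eq (x : g.V) :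
    g.stepMeasure x =
      ((g.succs x).card : ℝ≥0∞)⁻¹ • ∑ y ∈ g.succs x, Measure.dirac y := by
  classical
  have hc : (g.nbrs x : Set g.V) = g.graph.neighborSet x := by simp [nbrs]
  have hn : (g.nbrs x).Nonempty ↔ (g.graph.neighborSet x).Nonempty := by
    rw [← hc, Finset.coe_nonempty]
  refine Measure.ext_of_singleton fun y => ?_
  unfold stepMeasure succs
  by_cases h : (g.nbrs x).Nonempty
  · rw [if_pos (hn.1 h), if_pos h, ← hc, ← Finset.coe_singleton, uniformOn_apply_finset]
    simp only [Finset.coe_singleton, Measure.smul_apply, Measure.coe_finsetSum,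
      Finset.sum_apply, Measure.dirac_apply, smul_eq_mul]
    rw [ENNReal.div_eq_inv_mul]
    congr 1
    by_cases hy : y ∈ g.nbrs x
    · rw [Finset.inter_singleton_of_mem hy, Finset.card_singleton,
        Finset.sum_eq_single_of_mem y hy]
      · simp
      · intro z _ hz
        simp [hz]
    · rw [Finset.inter_singleton_of_notMem hy, Finset.card_empty, Finset.sum_eq_zero]
      · simp
      · intro z hz
        have : z ≠ y := fun h => hy (h ▸ hz)
        simp [this]
  · rw [if_neg (fun h' => h (hn.2 h')), if_neg h]
    simp

/-- The paths that agree with `z` up to time `n`. -/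
def cyl {V : Type*} (n : ℕ) (z : ℕ → V) : Set (ℕ → V) := {w | ∀ i ≤ n, w i = z i}

lemma measurableSet_cyl (n : ℕ) (z : ℕ → g.V) : MeasurableSet (cyl n z) := by
  have : cyl n z = ⋂ i, ⋂ (_ : i ≤ n), (fun w : ℕ → g.V => w i) ⁻¹' {z i} := by
    ext w; simp [cyl]
  rw [this]
  exact MeasurableSet.iInter fun i => MeasurableSet.iInter fun _ =>
    measurable_pi_apply i (MeasurableSet.singleton _)

lemma frestrictLe_preimage_singleton (n : ℕ) (z : ℕ → g.V) :
    (Preorder.frestrictLe (π := fun _ => g.V) n) ⁻¹'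
      {Preorder.frestrictLe (π := fun _ => g.V) n z} = cyl n z := by
  ext w
  simp only [Set.mem_preimage, Set.mem_singleton_iff, cyl, Set.mem_ofPred_eq, funext_iff]
  exact ⟨fun h i hi => h ⟨i, Finset.mem_Iic.2 hi⟩, fun h i => h i (Finset.mem_Iic.1 i.2)⟩

/-- A finite measure on the space of paths is determined by its values on cylinders, since the
vertex set is countable. -/
lemma ext_of_cyl {μ ν : Measure (ℕ → g.V)} [IsFiniteMeasure μ]
    (h : ∀ n z, μ (cyl n z) = ν (cyl n z)) : μ = ν := by
  have hm : ∀ n, μ.map (Preorder.frestrictLe (π := fun _ => g.V) n) =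
      ν.map (Preorder.frestrictLe (π := fun _ => g.V) n) := by
    intro n
    refine Measure.ext_of_singleton fun a => ?_
    obtain ⟨z, rfl⟩ : ∃ z : ℕ → g.V, Preorder.frestrictLe (π := fun _ => g.V) n z = a :=
      ⟨fun i => if hi : i ≤ n then a ⟨i, Finset.mem_Iic.2 hi⟩ else g.root, by
        funext i
        simp [Finset.mem_Iic.1 i.2]⟩
    rw [Measure.map_apply (by fun_prop) (MeasurableSet.singleton _),
      Measure.map_apply (by fun_prop) (MeasurableSet.singleton _),
      frestrictLe_preimage_singleton, h]
  have key : ∀ I : Finset ℕ, ν.map I.restrict = μ.map (I.restrict (π := fun _ => g.V)) := by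
    intro I
    have hI : I ⊆ Finset.Iic (I.sup id) := I.subset_Iic_sup_id
    rw [← Finset.restrict₂_comp_restrict hI, ← Measure.map_map (by fun_prop) (by fun_prop),
      ← Measure.map_map (by fun_prop) (by fun_prop)]
    exact congrArg _ (hm _).symm
  have h1 : IsProjectiveLimit (α := fun _ : ℕ => g.V) μ fun I => μ.map I.restrict :=
    fun _ => rfl
  exact h1.unique key

lemma walkFrom_cyl_zero (x : g.V) (z : ℕ → g.V) :
    g.walkFrom x (cyl 0 z) = Set.indicator {z 0} 1 x := by
  rw [← frestrictLe_preimage_singleton,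
    ← Measure.map_apply (by fun_prop) (MeasurableSet.singleton _), walkFrom,
    Kernel.traj_map_frestrictLe_apply, Kernel.partialTraj_self, Kernel.id_apply,
    Measure.dirac_apply]
  by_cases hx : x = z 0
  · have : (fun _ => x : (Finset.Iic 0) → g.V) = Preorder.frestrictLe (π := fun _ => g.V) 0 z := by
      funext i
      have hi : (i : ℕ) = 0 := Nat.le_zero.1 (Finset.mem_Iic.1 i.2)
      simp [hx, hi]
    rw [this]
    simp [hx]
  · have : (fun _ => x : (Finset.Iic 0) → g.V) ≠ Preorder.frestrictLe (π := fun _ => g.V) 0 z :=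
      fun h => hx (congrFun h ⟨0, by simp⟩)
    simpa [hx] using this

lemma walkFrom_cyl_succ (x : g.V) (n : ℕ) (z : ℕ → g.V) :
    g.walkFrom x (cyl (n + 1) z) =
      g.walkFrom x (cyl n z) * g.stepMeasure (z n) {z (n + 1)} := by
  have hset : cyl (n + 1) z = (fun w : ℕ → g.V =>
      (Preorder.frestrictLe (π := fun _ => g.V) n w, w (n + 1))) ⁻¹'
        ({Preorder.frestrictLe (π := fun _ => g.V) n z} ×ˢ {z (n + 1)}) := by
    ext w
    have := Set.ext_iff.1 (g.frestrictLe_preimage_singleton n z) w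
    simp only [Set.mem_preimage, Set.mem_singleton_iff] at this
    simp only [Set.mem_preimage, Set.mem_prod, Set.mem_singleton_iff, this]
    constructor
    · exact fun h => ⟨fun i hi => h i (by omega), h _ le_rfl⟩
    · rintro ⟨h1, h2⟩ i hi
      rcases Nat.lt_or_ge n i with h | h
      · obtain rfl : i = n + 1 := by omega
        exact h2
      · exact h1 i h
  rw [hset, walkFrom, ← Measure.map_apply (by fun_prop)
      ((MeasurableSet.singleton _).prod (MeasurableSet.singleton _)),
    ← Kernel.partialTraj_compProd_eq_map_traj (Nat.zero_le n),
    Measure.compProd_apply_prod (MeasurableSet.singleton _) (MeasurableSet.singleton _),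
    lintegral_singleton, ← Kernel.traj_map_frestrictLe_apply,
    Measure.map_apply (by fun_prop) (MeasurableSet.singleton _), frestrictLe_preimage_singleton,
    mul_comm]
  rfl

/-- The shift of a path by `k` time steps. -/
def shift {V : Type*} (k : ℕ) (w : ℕ → V) : ℕ → V := fun i => w (i + k)

lemma measurable_shift (k : ℕ) : Measurable (shift (V := g.V) k) :=
  measurable_pi_lambda _ fun i => measurable_pi_apply (i + k)

lemma walkFrom_zero_ne (x : g.V) : g.walkFrom x {w | w 0 = x}ᶜ = 0 := by
  have h : {w : ℕ → g.V | w 0 = x} = cyl 0 (fun _ => x) := by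
    ext w; simp [cyl]
  rw [prob_compl_eq_zero_iff (h ▸ g.measurableSet_cyl 0 _), h, walkFrom_cyl_zero]
  simp

lemma measurableSet_eval (n : ℕ) (x : g.V) : MeasurableSet {w : ℕ → g.V | w n = x} :=
  (measurable_pi_apply n : Measurable fun w : ℕ → g.V => w n) (MeasurableSet.singleton x)

lemma ae_walkFrom_zero (x : g.V) : ∀ᵐ w ∂g.walkFrom x, w 0 = x := g.walkFrom_zero_ne x

lemma walkFrom_zero_of_ne {x y : g.V} (h : x ≠ y) : g.walkFrom x {w | w 0 = y} = 0 := by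
  refine measure_mono_null ?_ (g.walkFrom_zero_ne x)
  intro w hw hx
  exact h (Eq.trans (Eq.symm hx) hw)

lemma walkFrom_cyl_of_ne {x : g.V} {n : ℕ} {z : ℕ → g.V} (h : x ≠ z 0) :
    g.walkFrom x (cyl n z) = 0 :=
  measure_mono_null (fun _ hw => hw 0 (Nat.zero_le n)) (g.walkFrom_zero_of_ne h)

/-- The probability of a cylinder shifted by one step. -/
lemma walkFrom_shift_cyl (x : g.V) (n : ℕ) (z : ℕ → g.V) :
    g.walkFrom x (shift 1 ⁻¹' cyl n z) =
      g.stepMeasure x {z 0} * g.walkFrom (z 0) (cyl n z) := by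
  -- The path `z`, preceded by the starting point.
  let z' : ℕ → g.V := fun i => Nat.casesOn i x z
  have h1 : g.walkFrom x (shift 1 ⁻¹' cyl n z) = g.walkFrom x (cyl (n + 1) z') := by
    refine measure_congr ?_
    filter_upwards [g.ae_walkFrom_zero x] with w hw
    refine propext (?_ : (∀ i ≤ n, w (i + 1) = z i) ↔ (∀ i ≤ n + 1, w i = z' i))
    constructor
    · rintro h (_ | i) hi
      · exact hw
      · exact h i (by omega)
    · exact fun h i hi => h (i + 1) (by omega)
  rw [h1]
  clear h1
  induction n with
  | zero =>
    rw [walkFrom_cyl_succ, walkFrom_cyl_zero, walkFrom_cyl_zero]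
    simp [z']
  | succ n ih =>
    rw [walkFrom_cyl_succ, ih, walkFrom_cyl_succ, mul_assoc]

/-- The Markov property at time `1`. -/
lemma walkFrom_shift_one (x : g.V) {B : Set (ℕ → g.V)} (hB : MeasurableSet B) :
    g.walkFrom x (shift 1 ⁻¹' B) =
      ((g.succs x).card : ℝ≥0∞)⁻¹ * ∑ y ∈ g.succs x, g.walkFrom y B := by
  have h : (g.walkFrom x).map (shift 1) =
      ((g.succs x).card : ℝ≥0∞)⁻¹ • ∑ y ∈ g.succs x, g.walkFrom y := by
    have : IsProbabilityMeasure ((g.walkFrom x).map (shift 1)) :=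
      Measure.isProbabilityMeasure_map (g.measurable_shift 1).aemeasurable
    refine g.ext_of_cyl fun n z => ?_
    rw [Measure.map_apply (g.measurable_shift 1) (g.measurableSet_cyl n z), walkFrom_shift_cyl,
      stepMeasure_eq]
    simp only [Measure.smul_apply, Measure.coe_finsetSum, Finset.sum_apply, smul_eq_mul]
    rw [mul_assoc, Finset.sum_mul]
    congr 1
    refine Finset.sum_congr rfl fun y _ => ?_
    by_cases hy : y = z 0
    · simp [hy]
    · simp [g.walkFrom_cyl_of_ne hy, hy]
  rw [← Measure.map_apply (g.measurable_shift 1) hB, h]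
  simp

lemma walkFrom_real_shift_one (x : g.V) {B : Set (ℕ → g.V)} (hB : MeasurableSet B) :
    (g.walkFrom x).real (shift 1 ⁻¹' B) = g.avg (fun y => (g.walkFrom y).real B) x := by
  rw [Measure.real, walkFrom_shift_one g x hB, ENNReal.toReal_mul, ENNReal.toReal_sum (by simp),
    avg, div_eq_inv_mul]
  simp [Measure.real]

/-- The Markov property at time `k`. -/
lemma walkFrom_real_shift (k : ℕ) (x : g.V) {B : Set (ℕ → g.V)} (hB : MeasurableSet B) :
    (g.walkFrom x).real (shift k ⁻¹' B) = g.avg^[k] (fun y => (g.walkFrom y).real B) x := by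
  induction k generalizing x with
  | zero => rfl
  | succ k ih =>
    have : shift (k + 1) ⁻¹' B = shift 1 ⁻¹' (shift (V := g.V) k ⁻¹' B) := by
      ext w
      have : shift (k + 1) w = shift k (shift 1 w) := by
        funext i; simp [shift, add_assoc]
      simp [this]
    rw [this, walkFrom_real_shift_one g x (g.measurable_shift k hB),
      Function.iterate_succ_apply']
    congr 1
    funext y
    exact ih y

lemma walkFrom_real_eval (n : ℕ) (x y : g.V) :
    (g.walkFrom x).real {w | w n = y} = g.tp n x y := by
  have h : {w : ℕ → g.V | w n = y} = shift n ⁻¹' {w | w 0 = y} := by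
    ext w; simp [shift]
  rw [h, walkFrom_real_shift g n x (g.measurableSet_eval 0 y), tp]
  refine congrFun (congrArg _ (funext fun v => ?_)) x
  by_cases hv : v = y
  · subst hv
    have h1 : (g.walkFrom v) {w | w 0 = v} = 1 :=
      (prob_compl_eq_zero_iff (g.measurableSet_eval 0 v)).1 (g.walkFrom_zero_ne v)
    simp [Measure.real, h1]
  · simp [Measure.real, g.walkFrom_zero_of_ne hv, hv]

/-- The Markov property at time `k`, jointly with the path up to time `k`. -/
lemma walkFrom_cyl_inter_shift (k : ℕ) (x : g.V) (z : ℕ → g.V) {B : Set (ℕ → g.V)}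
    (hB : MeasurableSet B) :
    (g.walkFrom x).real (cyl k z ∩ shift k ⁻¹' B) =
      (g.walkFrom x).real (cyl k z) * (g.walkFrom (z k)).real B := by
  by_cases hx : x = z 0
  swap
  · have h0 : g.walkFrom x (cyl k z) = 0 := g.walkFrom_cyl_of_ne hx
    have h1 := measure_mono_null (Set.inter_subset_left (t := shift k ⁻¹' B)) h0
    simp [Measure.real, h0, h1]
  induction k generalizing x z with
  | zero =>
    subst hx
    have h0 : cyl 0 z =ᵐ[g.walkFrom (z 0)] Set.univ := by
      refine eventuallyEq_set.2 ?_
      filter_upwards [g.ae_walkFrom_zero (z 0)] with w hw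
      simp [cyl, hw]
    have h1 : (cyl 0 z ∩ shift 0 ⁻¹' B : Set _) =ᵐ[g.walkFrom (z 0)]
        (Set.univ ∩ shift 0 ⁻¹' B : Set _) := h0.inter (ae_eq_refl _)
    rw [measureReal_congr h0, measureReal_congr h1, Set.univ_inter]
    simp only [probReal_univ, one_mul]
    rfl
  | succ k ih =>
    let z' : ℕ → g.V := fun i => z (i + 1)
    have hc : ∀ C : Set (ℕ → g.V), (cyl (k + 1) z ∩ shift (k + 1) ⁻¹' C : Set _)
        =ᵐ[g.walkFrom x] shift 1 ⁻¹' (cyl k z' ∩ shift k ⁻¹' C) := by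
      intro C
      refine eventuallyEq_set.2 ?_
      filter_upwards [g.ae_walkFrom_zero x] with w hw
      have hs : shift (k + 1) w = shift k (shift 1 w) := by
        funext i; simp [shift, add_assoc]
      simp only [Set.mem_inter_iff, Set.mem_preimage, hs]
      refine and_congr_left fun _ => ?_
      refine (?_ : (∀ i ≤ k + 1, w i = z i) ↔ ∀ i ≤ k, w (i + 1) = z (i + 1))
      constructor
      · exact fun h i hi => h (i + 1) (by omega)
      · rintro h (_ | i) hi
        · rw [hw, hx]
        · exact h i (by omega)
    have h2 : (g.walkFrom x).real (cyl (k + 1) z) =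
        g.avg (fun y => (g.walkFrom y).real (cyl k z')) x := by
      have := measureReal_congr (hc Set.univ)
      simp only [Set.preimage_univ, Set.inter_univ] at this
      rw [this, walkFrom_real_shift_one g x (g.measurableSet_cyl k z')]
    rw [measureReal_congr (hc B), h2, walkFrom_real_shift_one g x
      ((g.measurableSet_cyl k z').inter (g.measurable_shift k hB)), avg, avg,
      div_mul_eq_mul_div, Finset.sum_mul]
    congr 1
    refine Finset.sum_congr rfl fun y _ => ?_
    by_cases hy : y = z' 0
    · exact ih y z' hy
    · have h0 : g.walkFrom y (cyl k z') = 0 := g.walkFrom_cyl_of_ne hy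
      have h1 := measure_mono_null (Set.inter_subset_left (t := shift k ⁻¹' B)) h0
      simp [Measure.real, h0, h1]

end RootedGraph

end StatGraph


namespace StatGraph

open InformationTheory

/-! ### Inequalities for the Kullback–Leibler function -/

lemma klFun_le_sq {r : ℝ} (hr : 0 ≤ r) : klFun r ≤ (r - 1) ^ 2 := by
  rcases hr.eq_or_lt with rfl | hr
  · simp [klFun]
  · have := mul_le_mul_of_nonneg_left (Real.log_le_sub_one_of_pos hr) hr.le
    rw [klFun]
    nlinarith

lemma sq_sqrt_sub_one_le_klFun {r : ℝ} (hr : 0 ≤ r) : (√r - 1) ^ 2 ≤ klFun r := by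
  rcases hr.eq_or_lt with rfl | hr
  · simp [klFun]
  · have hs := Real.sqrt_pos.2 hr
    have h1 := Real.one_sub_inv_le_log_of_pos hs
    have h2 : Real.log r = 2 * Real.log √r := by
      rw [Real.log_sqrt hr.le]; ring
    have h3 : r = √r * √r := (Real.mul_self_sqrt hr.le).symm
    have h4 := mul_le_mul_of_nonneg_left h1 hr.le
    have h5 : r * (√r)⁻¹ = √r := by
      nth_rewrite 1 [h3]; field_simp
    rw [klFun, h2]
    nlinarith

/-- A weak form of Pinsker's inequality, through the Hellinger distance. -/
lemma sq_sum_abs_sub_le {β : Type*} (s : Finset β) (p q : β → ℝ) (hp : ∀ y ∈ s, 0 ≤ p y)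
    (hq : ∀ y ∈ s, 0 < q y) (hp1 : ∑ y ∈ s, p y = 1) (hq1 : ∑ y ∈ s, q y = 1) :
    (∑ y ∈ s, |p y - q y|) ^ 2 ≤ 4 * ∑ y ∈ s, q y * klFun (p y / q y) := by
  have hr : ∀ y ∈ s, 0 ≤ p y / q y := fun y hy => div_nonneg (hp y hy) (hq y hy).le
  have h1 : ∑ y ∈ s, |p y - q y| =
      ∑ y ∈ s, (√(q y) * |√(p y / q y) - 1|) * (√(q y) * (√(p y / q y) + 1)) := by
    refine Finset.sum_congr rfl fun y hy => ?_
    have e1 := Real.mul_self_sqrt (hq y hy).le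
    have e2 := Real.mul_self_sqrt (hr y hy)
    have e3 : 0 ≤ √(p y / q y) + 1 := by positivity
    calc |p y - q y| = |q y * ((√(p y / q y) - 1) * (√(p y / q y) + 1))| := by
          congr 1
          have : (√(p y / q y) - 1) * (√(p y / q y) + 1) = p y / q y - 1 := by
            rw [← e2]
            simp only [Real.sqrt_mul_self (Real.sqrt_nonneg _)]
            ring
          rw [this]
          have := (hq y hy).ne'
          field_simp
      _ = q y * (|√(p y / q y) - 1| * (√(p y / q y) + 1)) := by
          rw [abs_mul, abs_mul, abs_of_pos (hq y hy), abs_of_nonneg e3]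
      _ = _ := by
          nth_rewrite 1 [← e1]; ring
  have h2 : ∑ y ∈ s, (√(q y) * |√(p y / q y) - 1|) ^ 2 ≤ ∑ y ∈ s, q y * klFun (p y / q y) := by
    refine Finset.sum_le_sum fun y hy => ?_
    rw [mul_pow, sq_abs, Real.sq_sqrt (hq y hy).le]
    exact mul_le_mul_of_nonneg_left (sq_sqrt_sub_one_le_klFun (hr y hy)) (hq y hy).le
  have h3 : ∑ y ∈ s, (√(q y) * (√(p y / q y) + 1)) ^ 2 ≤ 4 := by
    calc ∑ y ∈ s, (√(q y) * (√(p y / q y) + 1)) ^ 2 ≤ ∑ y ∈ s, (2 * p y + 2 * q y) := by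
          refine Finset.sum_le_sum fun y hy => ?_
          rw [mul_pow, Real.sq_sqrt (hq y hy).le]
          have e2 := Real.sq_sqrt (hr y hy)
          have e4 : q y * (p y / q y) = p y := mul_div_cancel₀ _ (hq y hy).ne'
          have e5 : (√(p y / q y) + 1) ^ 2 ≤ 2 * (p y / q y) + 2 := by
            nlinarith [sq_nonneg (√(p y / q y) - 1)]
          have := mul_le_mul_of_nonneg_left e5 (hq y hy).le
          linarith
      _ = 4 := by
          rw [Finset.sum_add_distrib, ← Finset.mul_sum, ← Finset.mul_sum, hp1, hq1]; norm_num
  rw [h1]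
  refine (Finset.sum_mul_sq_le_sq_mul_sq _ _ _).trans ?_
  rw [mul_comm]
  exact mul_le_mul h3 h2 (Finset.sum_nonneg fun _ _ => sq_nonneg _) (by norm_num)

namespace RootedGraph

variable (g : RootedGraph)

/-! ### Entropy and mutual information of the walk -/

/-- The entropy of the position at time `n` of simple random walk from `x`, as a real number. -/
def posEntropy (n : ℕ) (x : g.V) : ℝ := ∑ y ∈ g.reach n x, Real.negMulLog (g.tp n x y)

/-- The mutual information of `X k` and `X (k + m)` for simple random walk from the root: the
entropy of `X (k + m)` minus its conditional entropy given `X k`. -/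
def mutualInfo (k m : ℕ) : ℝ :=
  g.posEntropy (k + m) g.root - g.avg^[k] (g.posEntropy m) g.root

/-- The Kullback–Leibler divergence of the conditional law of `X (k + m)` given `X k = x` with
respect to the law of `X (k + m)`, for simple random walk from the root. -/
def condDiv (k m : ℕ) (x : g.V) : ℝ :=
  ∑ y ∈ g.reach (k + m) g.root,
    g.tp (k + m) g.root y * klFun (g.tp m x y / g.tp (k + m) g.root y)

lemma condDiv_nonneg (k m : ℕ) (x : g.V) : 0 ≤ g.condDiv k m x :=
  Finset.sum_nonneg fun _ _ => mul_nonneg (g.tp_nonneg ..)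
    (klFun_nonneg (div_nonneg (g.tp_nonneg ..) (g.tp_nonneg ..)))

lemma condDiv_le_chiSq (k m : ℕ) (x : g.V) :
    g.condDiv k m x ≤ ∑ y ∈ g.reach (k + m) g.root,
      g.tp (k + m) g.root y * (g.tp m x y / g.tp (k + m) g.root y - 1) ^ 2 :=
  Finset.sum_le_sum fun _ _ => mul_le_mul_of_nonneg_left
    (klFun_le_sq (div_nonneg (g.tp_nonneg ..) (g.tp_nonneg ..))) (g.tp_nonneg ..)

lemma sq_totalVariation_le_condDiv (k m : ℕ) {x : g.V} (hx : x ∈ g.reach k g.root) :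
    (∑ y ∈ g.reach (k + m) g.root, |g.tp m x y - g.tp (k + m) g.root y|) ^ 2
      ≤ 4 * g.condDiv k m x :=
  sq_sum_abs_sub_le _ _ _ (fun _ _ => g.tp_nonneg ..) (fun _ hy => g.tp_pos_iff.2 hy)
    (g.sum_tp_of_subset m x (g.reach_subset_reach_add hx))
    (g.sum_tp_of_subset (k + m) g.root subset_rfl)

/-- The data-processing inequality for one more step of the walk: by Jensen's inequality, the
position at time `k + m + 1` carries less information about `X k` than that at time `k + m`. -/
lemma condDiv_succ_le (k m : ℕ) {x : g.V} (hx : x ∈ g.reach k g.root) :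
    g.condDiv k (m + 1) x ≤ g.condDiv k m x := by
  set B := g.reach (k + m) g.root with hB
  set q : g.V → ℝ := g.tp (k + m) g.root with hq
  set r : g.V → ℝ := fun y => g.tp m x y / q y with hr
  have hq0 : ∀ y ∈ B, 0 < q y := fun y hy => g.tp_pos_iff.2 hy
  have hr0 : ∀ y, 0 ≤ r y := fun y => div_nonneg (g.tp_nonneg ..) (g.tp_nonneg ..)
  have h1 : ∀ z, g.tp (k + (m + 1)) g.root z = ∑ y ∈ B, q y * g.tp 1 y z := fun z =>
    g.tp_add (k + m) 1 g.root z
  have h2 : ∀ z, g.tp (m + 1) x z = ∑ y ∈ B, q y * g.tp 1 y z * r y := by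
    intro z
    rw [tp, Function.iterate_add_apply,
      g.iterate_avg_eq_sum_of_subset m _ x (g.reach_subset_reach_add hx)]
    refine Finset.sum_congr rfl fun y hy => ?_
    have := (hq0 y hy).ne'
    simp only [hr]
    rw [mul_right_comm, mul_div_cancel₀ _ this]
    rfl
  have key : ∀ z ∈ g.reach (k + (m + 1)) g.root,
      g.tp (k + (m + 1)) g.root z * klFun (g.tp (m + 1) x z / g.tp (k + (m + 1)) g.root z)
        ≤ ∑ y ∈ B, q y * g.tp 1 y z * klFun (r y) := by
    intro z hz
    have hz0 : 0 < g.tp (k + (m + 1)) g.root z := g.tp_pos_iff.2 hz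
    set q' := g.tp (k + (m + 1)) g.root z with hq'
    have hj := convexOn_klFun.map_sum_le (t := B) (w := fun y => q y * g.tp 1 y z / q')
      (p := r) (fun y _ => div_nonneg (mul_nonneg (g.tp_nonneg ..) (g.tp_nonneg ..)) hz0.le)
      (by rw [← Finset.sum_div, ← h1, div_self hz0.ne']) (fun y _ => hr0 y)
    simp only [smul_eq_mul] at hj
    have e1 : ∑ y ∈ B, q y * g.tp 1 y z / q' * r y = g.tp (m + 1) x z / q' := by
      rw [h2, Finset.sum_div]
      exact Finset.sum_congr rfl fun y _ => by ring
    rw [e1] at hj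
    refine (mul_le_mul_of_nonneg_left hj hz0.le).trans_eq ?_
    rw [Finset.mul_sum]
    refine Finset.sum_congr rfl fun y _ => ?_
    field_simp
  refine (Finset.sum_le_sum key).trans_eq ?_
  rw [Finset.sum_comm]
  refine Finset.sum_congr rfl fun y hy => ?_
  rw [← Finset.sum_mul, ← Finset.mul_sum,
    g.sum_tp_of_subset 1 y (s := g.reach (k + (m + 1)) g.root)
      (g.reach_subset_reach_add (n := 1) hy), mul_one]

lemma antitone_condDiv (k : ℕ) {x : g.V} (hx : x ∈ g.reach k g.root) :
    Antitone fun m => g.condDiv k m x :=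
  antitone_nat_of_succ_le fun m => g.condDiv_succ_le k m hx

lemma posEntropy_eq_sum_of_subset (n : ℕ) (x : g.V) {s : Finset g.V} (hs : g.reach n x ⊆ s) :
    g.posEntropy n x = ∑ y ∈ s, Real.negMulLog (g.tp n x y) :=
  Finset.sum_subset hs fun y _ hy => by simp [g.tp_eq_zero hy]

/-- Mutual information is the average of the divergences of the conditional laws. -/
lemma mutualInfo_eq_sum (k m : ℕ) :
    g.mutualInfo k m = ∑ x ∈ g.reach k g.root, g.tp k g.root x * g.condDiv k m x := by
  set B := g.reach (k + m) g.root with hB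
  set q : g.V → ℝ := g.tp (k + m) g.root with hq
  have hq0 : ∀ y ∈ B, 0 < q y := fun y hy => g.tp_pos_iff.2 hy
  have h1 : ∀ x ∈ g.reach k g.root, g.condDiv k m x =
      -g.posEntropy m x - ∑ y ∈ B, g.tp m x y * Real.log (q y) := by
    intro x hx
    have hs : g.reach m x ⊆ B := g.reach_subset_reach_add hx
    have e : ∀ y ∈ B, q y * klFun (g.tp m x y / q y) =
        -Real.negMulLog (g.tp m x y) - g.tp m x y * Real.log (q y) + q y - g.tp m x y := by
      intro y hy
      have hy0 := (hq0 y hy).ne'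
      rcases (g.tp_nonneg m x y).eq_or_lt with h | h
      · simp [← h, klFun]
      · rw [klFun, Real.log_div h.ne' hy0, Real.negMulLog]
        field_simp
    rw [condDiv, Finset.sum_congr rfl e, g.posEntropy_eq_sum_of_subset m x hs,
      Finset.sum_sub_distrib, Finset.sum_add_distrib, Finset.sum_sub_distrib,
      g.sum_tp_of_subset m x hs, g.sum_tp_of_subset (k + m) g.root subset_rfl,
      Finset.sum_neg_distrib]
    ring
  have h2 : ∑ x ∈ g.reach k g.root, g.tp k g.root x * ∑ y ∈ B, g.tp m x y * Real.log (q y)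
      = -g.posEntropy (k + m) g.root := by
    simp_rw [Finset.mul_sum]
    rw [Finset.sum_comm, posEntropy, ← Finset.sum_neg_distrib]
    refine Finset.sum_congr rfl fun y _ => ?_
    simp_rw [← mul_assoc]
    rw [← Finset.sum_mul, ← g.tp_add k m g.root y, Real.negMulLog]
    ring
  rw [Finset.sum_congr rfl fun x hx => by rw [h1 x hx, mul_sub], Finset.sum_sub_distrib, h2,
    mutualInfo, iterate_avg_eq_sum]
  simp only [mul_neg, Finset.sum_neg_distrib]
  ring

lemma mutualInfo_nonneg (k m : ℕ) : 0 ≤ g.mutualInfo k m := by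
  rw [mutualInfo_eq_sum]
  exact Finset.sum_nonneg fun x _ => mul_nonneg (g.tp_nonneg ..) (g.condDiv_nonneg ..)

lemma antitone_mutualInfo (k : ℕ) : Antitone (g.mutualInfo k) := by
  refine antitone_nat_of_succ_le fun m => ?_
  rw [mutualInfo_eq_sum, mutualInfo_eq_sum]
  exact Finset.sum_le_sum fun x hx =>
    mul_le_mul_of_nonneg_left (g.condDiv_succ_le k m hx) (g.tp_nonneg ..)

lemma negMulLog_tp_nonneg (n : ℕ) (x y : g.V) : 0 ≤ Real.negMulLog (g.tp n x y) := by
  by_cases hy : y ∈ g.reach n x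
  · exact Real.negMulLog_nonneg (g.tp_nonneg ..)
      ((Finset.single_le_sum (f := g.tp n x) (fun _ _ => g.tp_nonneg ..) hy).trans_eq
        (g.sum_tp_of_subset n x subset_rfl))
  · simp [g.tp_eq_zero hy]

lemma posEntropy_nonneg (n : ℕ) (x : g.V) : 0 ≤ g.posEntropy n x :=
  Finset.sum_nonneg fun y _ => g.negMulLog_tp_nonneg n x y

lemma entropy_eq (n : ℕ) : g.entropy n = ENNReal.ofReal (g.posEntropy n g.root) := by
  have h : ∀ x, g.walkLaw.real {w | w n = x} = g.tp n g.root x :=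
    fun x => g.walkFrom_real_eval n g.root x
  simp only [entropy, h]
  rw [tsum_eq_sum (s := g.reach n g.root) fun y hy => by simp [g.tp_eq_zero hy], posEntropy,
    ENNReal.ofReal_sum_of_nonneg fun y _ => g.negMulLog_tp_nonneg n g.root y]

end RootedGraph

end StatGraph


namespace StatGraph

namespace RootedGraph

variable (g : RootedGraph)

/-! ### Vanishing information implies a trivial tail -/

lemma abs_iterate_avg_sub_le (k m : ℕ) {x : g.V} (hx : x ∈ g.reach k g.root) {f : g.V → ℝ}
    {C : ℝ} (hf : ∀ y, |f y| ≤ C) :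
    |g.avg^[m] f x - g.avg^[k + m] f g.root| ≤
      C * ∑ y ∈ g.reach (k + m) g.root, |g.tp m x y - g.tp (k + m) g.root y| := by
  rw [g.iterate_avg_eq_sum_of_subset m f x (g.reach_subset_reach_add hx), iterate_avg_eq_sum,
    ← Finset.sum_sub_distrib, Finset.mul_sum]
  refine (Finset.abs_sum_le_sum_abs _ _).trans (Finset.sum_le_sum fun y _ => ?_)
  rw [← sub_mul, abs_mul, mul_comm]
  exact mul_le_mul_of_nonneg_right (hf y) (abs_nonneg _)

/-- If the divergence of the law of `X (k + m)` given `X k = x` vanishes as `m → ∞`, then so does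
the total variation distance. -/
lemma tendsto_totalVariation {k : ℕ} {x : g.V} (hx : x ∈ g.reach k g.root)
    (h : Tendsto (fun m => g.condDiv k m x) atTop (𝓝 0)) :
    Tendsto (fun m => ∑ y ∈ g.reach (k + m) g.root, |g.tp m x y - g.tp (k + m) g.root y|)
      atTop (𝓝 0) := by
  have h1 : Tendsto (fun m => √(4 * g.condDiv k m x)) atTop (𝓝 0) := by
    simpa using (h.const_mul 4).sqrt
  exact squeeze_zero (fun m => Finset.sum_nonneg fun _ _ => abs_nonneg _)
    (fun m => Real.le_sqrt_of_sq_le (g.sq_totalVariation_le_condDiv k m hx)) h1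

lemma exists_shift_preimage_of_tail {A : Set (ℕ → g.V)} (hA : MeasurableSet[g.tailSigma] A)
    (n : ℕ) : ∃ B, MeasurableSet B ∧ shift n ⁻¹' B = A := by
  have hle : g.tailSigma ≤ MeasurableSpace.comap (shift n) MeasurableSpace.pi := by
    refine (iInf_le _ n).trans (iSup₂_le fun k hk => ?_)
    rintro _ ⟨t, ht, rfl⟩
    refine ⟨(fun w : ℕ → g.V => w (k - n)) ⁻¹' t, measurable_pi_apply _ ht, ?_⟩
    ext w
    simp [shift, Nat.sub_add_cancel hk]
  exact hle A hA

lemma measurableSet_of_tail {A : Set (ℕ → g.V)} (hA : MeasurableSet[g.tailSigma] A) :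
    MeasurableSet A := by
  obtain ⟨B, hB, rfl⟩ := g.exists_shift_preimage_of_tail hA 0
  exact g.measurable_shift 0 hB

/-- If the position at any time has vanishing influence on the far future, then a tail event is
independent of every cylinder, hence of itself. -/
theorem tailTrivial_of_tendsto_condDiv
    (h : ∀ k, ∀ x ∈ g.reach k g.root, Tendsto (fun m => g.condDiv k m x) atTop (𝓝 0)) :
    g.TailTrivial := by
  intro A hA
  rw [walkLaw_eq]
  set μ := g.walkFrom g.root with hμ
  have hAm := g.measurableSet_of_tail hA
  have hcyl : ∀ k z, μ.real (cyl k z ∩ A) = μ.real (cyl k z) * μ.real A := by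
    intro k z
    by_cases hz : z k ∈ g.reach k g.root
    swap
    · have h0 : μ.real (cyl k z) = 0 := by
        refine le_antisymm ?_ measureReal_nonneg
        rw [← g.tp_eq_zero hz, ← g.walkFrom_real_eval]
        exact measureReal_mono fun w hw => hw k le_rfl
      rw [h0, zero_mul]
      exact le_antisymm ((measureReal_mono Set.inter_subset_left).trans h0.le) measureReal_nonneg
    have hb : ∀ m, |μ.real (cyl k z ∩ A) - μ.real (cyl k z) * μ.real A| ≤
        ∑ y ∈ g.reach (k + m) g.root, |g.tp m (z k) y - g.tp (k + m) g.root y| := by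
      intro m
      obtain ⟨B, hB, hBA⟩ := g.exists_shift_preimage_of_tail hA (k + m)
      have hs : A = shift k ⁻¹' (shift m ⁻¹' B) := by
        rw [← hBA]
        ext w
        have : shift (k + m) w = shift m (shift k w) := by
          funext i; simp only [shift]; congr 1; omega
        simp [this]
      have e1 : μ.real (cyl k z ∩ A) =
          μ.real (cyl k z) * g.avg^[m] (fun y => (g.walkFrom y).real B) (z k) := by
        rw [hs, walkFrom_cyl_inter_shift g k _ z (g.measurable_shift m hB),
          walkFrom_real_shift g m _ hB]
      have e2 : μ.real A = g.avg^[k + m] (fun y => (g.walkFrom y).real B) g.root := by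
        rw [← hBA, walkFrom_real_shift g _ _ hB]
      rw [e1, e2, ← mul_sub, abs_mul, abs_of_nonneg measureReal_nonneg]
      have h1 := g.abs_iterate_avg_sub_le k m hz (f := fun y => (g.walkFrom y).real B) (C := 1)
        fun y => by
          rw [abs_of_nonneg measureReal_nonneg]
          exact measureReal_le_one
      rw [one_mul] at h1
      exact (mul_le_of_le_one_left (abs_nonneg _) measureReal_le_one).trans h1
    have h0 := ge_of_tendsto' (g.tendsto_totalVariation hz (h k _ hz)) hb
    exact sub_eq_zero.1 (abs_nonpos_iff.1 h0)
  have hind : μ.restrict A = μ A • μ := by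
    refine g.ext_of_cyl fun k z => ?_
    rw [Measure.restrict_apply (g.measurableSet_cyl k z), Measure.smul_apply, smul_eq_mul]
    have := hcyl k z
    rw [Measure.real, Measure.real, Measure.real, ← ENNReal.toReal_mul] at this
    rw [(ENNReal.toReal_eq_toReal_iff' (measure_ne_top _ _)
      (ENNReal.mul_ne_top (measure_ne_top _ _) (measure_ne_top _ _))).1 this, mul_comm]
  have hself : μ A = μ A * μ A := by
    have := congrArg (fun ν : Measure _ => ν A) hind
    simpa [Measure.restrict_apply hAm] using this
  by_cases h0 : μ A = 0
  · exact Or.inl h0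
  · right
    have := (ENNReal.mul_eq_left h0 (measure_ne_top _ _)).1 hself.symm
    exact this

/-! ### A trivial tail implies vanishing information -/

/-- The Markov property at time `k`, for integrals. -/
lemma integral_shift (k : ℕ) (x : g.V) {F : (ℕ → g.V) → ℝ} (hF : Measurable F) {C : ℝ}
    (hC : ∀ w, |F w| ≤ C) :
    ∫ w, F (shift k w) ∂g.walkFrom x = g.avg^[k] (fun y => ∫ w, F w ∂g.walkFrom y) x := by
  have hmap : (g.walkFrom x).map (shift k) =
      ∑ y ∈ g.reach k x, ENNReal.ofReal (g.tp k x y) • g.walkFrom y := by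
    ext B hB
    rw [Measure.map_apply (g.measurable_shift k) hB, ← ofReal_measureReal,
      walkFrom_real_shift g k x hB, iterate_avg_eq_sum, ENNReal.ofReal_sum_of_nonneg
        fun _ _ => mul_nonneg (g.tp_nonneg ..) measureReal_nonneg]
    simp only [Measure.coe_finsetSum, Finset.sum_apply, Measure.smul_apply, smul_eq_mul]
    refine Finset.sum_congr rfl fun y _ => ?_
    rw [ENNReal.ofReal_mul (g.tp_nonneg ..), ofReal_measureReal]
  have hint : ∀ y, Integrable F (g.walkFrom y) := fun y =>
    Integrable.of_bound hF.aestronglyMeasurable C (ae_of_all _ hC)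
  rw [← integral_map (g.measurable_shift k).aemeasurable hF.aestronglyMeasurable, hmap,
    integral_finsetSum_measure fun y _ => (hint y).smul_measure ENNReal.ofReal_ne_top,
    iterate_avg_eq_sum]
  refine Finset.sum_congr rfl fun y _ => ?_
  rw [integral_smul_measure, ENNReal.toReal_ofReal (g.tp_nonneg ..), smul_eq_mul]

lemma measurable_comp_eval (n : ℕ) (f : g.V → ℝ) : Measurable fun w : ℕ → g.V => f (w n) :=
  (Measurable.of_discrete (f := f)).comp (measurable_pi_apply n)

/-- The joint law of the positions at times `n` and `n + d`. -/
lemma integral_mul_eval (n d : ℕ) (x : g.V) {f f' : g.V → ℝ} {C : ℝ} (hf : ∀ y, |f y| ≤ C)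
    (hf' : ∀ y, |f' y| ≤ C) :
    ∫ w, f (w n) * f' (w (n + d)) ∂g.walkFrom x = g.avg^[n] (fun y => f y * g.avg^[d] f' y) x := by
  have h0 : ∀ y, ∫ w, f' (w 0) ∂g.walkFrom y = f' y := by
    intro y
    have : (fun w : ℕ → g.V => f' (w 0)) =ᵐ[g.walkFrom y] fun _ => f' y := by
      filter_upwards [g.ae_walkFrom_zero y] with w hw
      rw [hw]
    rw [integral_congr_ae this]
    simp
  have h1 : ∀ y, ∫ w, f' (w d) ∂g.walkFrom y = g.avg^[d] f' y := by
    intro y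
    have := g.integral_shift d y (g.measurable_comp_eval 0 f') (fun w => hf' (w 0))
    simp only [h0] at this
    rw [← this]
    simp [shift]
  have h2 : ∀ y, ∫ w, f (w 0) * f' (w d) ∂g.walkFrom y = f y * g.avg^[d] f' y := by
    intro y
    have : (fun w : ℕ → g.V => f (w 0) * f' (w d)) =ᵐ[g.walkFrom y] fun w => f y * f' (w d) := by
      filter_upwards [g.ae_walkFrom_zero y] with w hw
      rw [hw]
    rw [integral_congr_ae this, integral_const_mul, h1]
  have h3 := g.integral_shift n x (F := fun w => f (w 0) * f' (w d))
    ((g.measurable_comp_eval 0 f).mul (g.measurable_comp_eval d f')) (C := C * C) fun w => by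
      rw [abs_mul]
      exact mul_le_mul (hf _) (hf' _) (abs_nonneg _) ((abs_nonneg _).trans (hf (w 0)))
  simp only [h2] at h3
  rw [← h3]
  simp [shift, add_comm]

/-- The likelihood ratio `P (X (k + m) = y | X k = x) / P (X (k + m) = y)`. By Bayes' rule its
value at `X (k + m)` is the conditional probability of `X k = x` given the path from time `k + m`
on, divided by `P (X k = x)`, so that it is a reverse martingale in `m`. -/
def ratio (k : ℕ) (x : g.V) (m : ℕ) (y : g.V) : ℝ := g.tp m x y / g.tp (k + m) g.root y

lemma ratio_nonneg (k : ℕ) (x : g.V) (m : ℕ) (y : g.V) : 0 ≤ g.ratio k x m y :=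
  div_nonneg (g.tp_nonneg ..) (g.tp_nonneg ..)

lemma abs_ratio_le {k : ℕ} {x : g.V} (hx : x ∈ g.reach k g.root) (m : ℕ) (y : g.V) :
    |g.ratio k x m y| ≤ (g.tp k g.root x)⁻¹ := by
  rw [abs_of_nonneg (g.ratio_nonneg ..), ratio]
  have hx0 : 0 < g.tp k g.root x := g.tp_pos_iff.2 hx
  have h1 : g.tp k g.root x * g.tp m x y ≤ g.tp (k + m) g.root y := by
    rw [tp_add]
    exact Finset.single_le_sum (f := fun z => g.tp k g.root z * g.tp m z y)
      (fun _ _ => mul_nonneg (g.tp_nonneg ..) (g.tp_nonneg ..)) hx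
  rcases (g.tp_nonneg (k + m) g.root y).eq_or_lt with h | h
  · rw [← h, div_zero]
    positivity
  · rw [div_le_iff₀ h, inv_mul_eq_div, le_div_iff₀ hx0, mul_comm]
    exact h1

/-- The second moment of the likelihood ratio. -/
def ratioSq (k : ℕ) (x : g.V) (m : ℕ) : ℝ :=
  ∑ y ∈ g.reach (k + m) g.root, g.tp m x y * g.ratio k x m y

lemma tp_mul_ratio {k m : ℕ} {x y : g.V} (hy : y ∈ g.reach (k + m) g.root) :
    g.tp (k + m) g.root y * g.ratio k x m y = g.tp m x y :=
  mul_div_cancel₀ _ (g.tp_pos_iff.2 hy).ne'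

/-- Orthogonality of the increments of the reverse martingale of likelihood ratios. -/
lemma integral_ratio_mul {k : ℕ} {x : g.V} (hx : x ∈ g.reach k g.root) (i d : ℕ) :
    ∫ w, g.ratio k x i (w (k + i)) * g.ratio k x (i + d) (w (k + (i + d))) ∂g.walkFrom g.root =
      g.ratioSq k x (i + d) := by
  have := g.integral_mul_eval (k + i) d g.root (g.abs_ratio_le hx i) (g.abs_ratio_le hx (i + d))
  rw [add_assoc k i d] at this
  rw [this, iterate_avg_eq_sum]
  have e : ∀ y ∈ g.reach (k + i) g.root, g.tp (k + i) g.root y *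
      (g.ratio k x i y * g.avg^[d] (g.ratio k x (i + d)) y) =
      g.tp i x y * g.avg^[d] (g.ratio k x (i + d)) y := fun y hy => by
    rw [← mul_assoc, tp_mul_ratio g hy]
  rw [Finset.sum_congr rfl e,
    ← g.iterate_avg_eq_sum_of_subset i _ x (g.reach_subset_reach_add hx),
    ← Function.iterate_add_apply,
    g.iterate_avg_eq_sum_of_subset (i + d) _ x (g.reach_subset_reach_add hx)]
  rfl

lemma integral_ratio {k : ℕ} {x : g.V} (hx : x ∈ g.reach k g.root) (m : ℕ) :
    ∫ w, g.ratio k x m (w (k + m)) ∂g.walkFrom g.root = 1 := by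
  have := g.integral_mul_eval (k + m) 0 g.root (f := g.ratio k x m) (f' := fun _ => 1)
    (C := max (g.tp k g.root x)⁻¹ 1) (fun y => (g.abs_ratio_le hx m y).trans (le_max_left _ _))
    (fun y => by simp)
  simp only [mul_one, iterate_avg_const] at this
  rw [this, iterate_avg_eq_sum,
    Finset.sum_congr rfl fun y hy => g.tp_mul_ratio (x := x) hy]
  exact g.sum_tp_of_subset m x (g.reach_subset_reach_add hx)

lemma condDiv_le_ratioSq_sub_one {k : ℕ} {x : g.V} (hx : x ∈ g.reach k g.root) (m : ℕ) :
    g.condDiv k m x ≤ g.ratioSq k x m - 1 := by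
  refine (g.condDiv_le_chiSq k m x).trans_eq ?_
  have e : ∀ y ∈ g.reach (k + m) g.root, g.tp (k + m) g.root y *
      (g.tp m x y / g.tp (k + m) g.root y - 1) ^ 2 =
      g.tp m x y * g.ratio k x m y - 2 * g.tp m x y + g.tp (k + m) g.root y := by
    intro y hy
    rw [← g.tp_mul_ratio (x := x) hy, mul_div_cancel_left₀ _ (g.tp_pos_iff.2 hy).ne']
    ring
  rw [Finset.sum_congr rfl e, Finset.sum_add_distrib, Finset.sum_sub_distrib, ← Finset.mul_sum,
    g.sum_tp_of_subset m x (g.reach_subset_reach_add hx),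
    g.sum_tp_of_subset (k + m) g.root subset_rfl, ratioSq]
  ring

end RootedGraph

end StatGraph


namespace StatGraph

namespace RootedGraph

variable (g : RootedGraph)

/-- The likelihood ratio at time `k + m`, as a function of the path. -/
def pathRatio (k : ℕ) (x : g.V) (m : ℕ) (w : ℕ → g.V) : ℝ := g.ratio k x m (w (k + m))

lemma measurable_pathRatio (k : ℕ) (x : g.V) (m : ℕ) : Measurable (g.pathRatio k x m) :=
  g.measurable_comp_eval (k + m) _

lemma memLp_pathRatio {k : ℕ} {x : g.V} (hx : x ∈ g.reach k g.root) (m : ℕ) :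
    MemLp (g.pathRatio k x m) 2 (g.walkFrom g.root) :=
  MemLp.of_bound (g.measurable_pathRatio k x m).aestronglyMeasurable (g.tp k g.root x)⁻¹
    (ae_of_all _ fun w => g.abs_ratio_le hx m (w (k + m)))

lemma inner_pathRatio {k : ℕ} {x : g.V} (hx : x ∈ g.reach k g.root) (i d : ℕ) :
    inner ℝ (g.memLp_pathRatio hx (i + d)).toLp (g.memLp_pathRatio hx i).toLp =
      g.ratioSq k x (i + d) := by
  rw [L2.inner_def, ← g.integral_ratio_mul hx i d]
  refine integral_congr_ae ?_
  filter_upwards [(g.memLp_pathRatio hx (i + d)).coeFn_toLp, (g.memLp_pathRatio hx i).coeFn_toLp]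
    with w h1 h2
  rw [h1, h2]
  rfl

lemma norm_sub_pathRatio_sq {k : ℕ} {x : g.V} (hx : x ∈ g.reach k g.root) (i d : ℕ) :
    ‖(g.memLp_pathRatio hx (i + d)).toLp - (g.memLp_pathRatio hx i).toLp‖ ^ 2 =
      g.ratioSq k x i - g.ratioSq k x (i + d) := by
  rw [norm_sub_sq_real, ← real_inner_self_eq_norm_sq, ← real_inner_self_eq_norm_sq,
    g.inner_pathRatio hx i d]
  have h1 := g.inner_pathRatio hx (i + d) 0
  have h2 := g.inner_pathRatio hx i 0
  simp only [add_zero] at h1 h2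
  rw [h1, h2]
  ring

/-- The likelihood ratios converge in `L²`, being a reverse martingale. -/
lemma exists_tendsto_pathRatio {k : ℕ} {x : g.V} (hx : x ∈ g.reach k g.root) :
    ∃ v : Lp ℝ 2 (g.walkFrom g.root),
      Tendsto (fun m => (g.memLp_pathRatio hx m).toLp) atTop (𝓝 v) := by
  have hanti : Antitone (g.ratioSq k x) := by
    refine antitone_nat_of_succ_le fun m => ?_
    have := sq_nonneg ‖(g.memLp_pathRatio hx (m + 1)).toLp - (g.memLp_pathRatio hx m).toLp‖
    rw [g.norm_sub_pathRatio_sq hx m 1] at this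
    linarith
  have hbdd : BddBelow (Set.range (g.ratioSq k x)) := by
    refine ⟨0, ?_⟩
    rintro _ ⟨m, rfl⟩
    exact Finset.sum_nonneg fun _ _ => mul_nonneg (g.tp_nonneg ..) (g.ratio_nonneg ..)
  have hlim := tendsto_atTop_ciInf hanti hbdd
  refine cauchySeq_tendsto_of_complete (Metric.cauchySeq_iff'.2 fun ε hε => ?_)
  obtain ⟨N, hN⟩ := (hlim.eventually_lt_const
    (lt_add_of_pos_right (⨅ m, g.ratioSq k x m) (pow_pos hε 2))).exists
  refine ⟨N, fun n hn => ?_⟩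
  obtain ⟨d, rfl⟩ := Nat.exists_eq_add_of_le hn
  rw [dist_eq_norm]
  refine lt_of_pow_lt_pow_left₀ 2 hε.le ?_
  rw [g.norm_sub_pathRatio_sq hx N d]
  have := ciInf_le hbdd (N + d)
  linarith

lemma measurable_tail_limsup {n : ℕ → ℕ} (hn : StrictMono n) (k : ℕ) (F : ℕ → g.V → ℝ≥0∞) :
    Measurable[g.tailSigma] fun w : ℕ → g.V =>
      limsup (fun i => F (n i) (w (k + n i))) atTop := by
  intro s hs
  refine MeasurableSpace.measurableSet_iInf.2 fun N => ?_
  have h : (fun w : ℕ → g.V => limsup (fun i => F (n i) (w (k + n i))) atTop) =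
      fun w => limsup (fun i => F (n (i + N)) (w (k + n (i + N)))) atTop := by
    funext w
    exact (limsup_nat_add (fun i => F (n i) (w (k + n i))) N).symm
  rw [h]
  refine @Measurable.limsup _ _ (_) _ _ _ _ _ _ _ (fun i => ?_) _ hs
  have hle : N ≤ k + n (i + N) := by
    have := hn.le_apply (x := i + N)
    omega
  have hm : Measurable[⨆ j : ℕ, ⨆ _ : N ≤ j,
      MeasurableSpace.comap (fun w : ℕ → g.V => w j) inferInstance]
      (fun w : ℕ → g.V => w (k + n (i + N))) :=
    measurable_iff_comap_le.2 (le_iSup₂_of_le (k + n (i + N)) hle le_rfl)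
  exact (Measurable.of_discrete (f := F (n (i + N)))).comp hm

/-- If the tail is trivial, then the position at any time has vanishing influence on the far
future: the likelihood ratios converge to a tail-measurable limit with mean `1`. -/
theorem tendsto_condDiv_of_tailTrivial (hg : g.TailTrivial) {k : ℕ} {x : g.V}
    (hx : x ∈ g.reach k g.root) : Tendsto (fun m => g.condDiv k m x) atTop (𝓝 0) := by
  set μ := g.walkFrom g.root with hμ
  set M := (g.tp k g.root x)⁻¹ with hM
  obtain ⟨v, hv⟩ := g.exists_tendsto_pathRatio hx
  obtain ⟨n, hn, hnv⟩ := (tendstoInMeasure_of_tendsto_Lp hv).exists_seq_tendsto_ae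
  have hlim : ∀ᵐ w ∂μ, Tendsto (fun i => g.pathRatio k x (n i) w) atTop (𝓝 (v w)) := by
    have h := ae_all_iff.2 fun i => (g.memLp_pathRatio hx (n i)).coeFn_toLp
    filter_upwards [hnv, h] with w h1 h2
    exact h1.congr h2
  have hb : ∀ m w, |g.pathRatio k x m w| ≤ M := fun m w => g.abs_ratio_le hx m _
  have hmean : ∀ m, ∫⁻ w, ENNReal.ofReal (g.pathRatio k x m w) ∂μ = 1 := by
    intro m
    rw [← ofReal_integral_eq_lintegral_ofReal
      (Integrable.of_bound (g.measurable_pathRatio k x m).aestronglyMeasurable M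
        (ae_of_all _ fun w => hb m w)) (ae_of_all _ fun w => g.ratio_nonneg k x m _)]
    have : ∫ w, g.pathRatio k x m w ∂μ = 1 := g.integral_ratio hx m
    rw [this, ENNReal.ofReal_one]
  -- The limit of the likelihood ratios, chosen so as to be tail-measurable everywhere.
  set U : (ℕ → g.V) → ℝ≥0∞ := fun w =>
    limsup (fun i => ENNReal.ofReal (g.pathRatio k x (n i) w)) atTop with hU
  have hUm : Measurable[g.tailSigma] U :=
    g.measurable_tail_limsup hn k fun m y => ENNReal.ofReal (g.ratio k x m y)
  have hUv : ∀ᵐ w ∂μ, U w = ENNReal.ofReal (v w) := by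
    filter_upwards [hlim] with w hw
    exact ((ENNReal.continuous_ofReal.tendsto _).comp hw).limsup_eq
  have hUmeas : Measurable U := fun s hs => g.measurableSet_of_tail (hUm hs)
  have hUint : ∫⁻ w, U w ∂μ = 1 := by
    have h1 : Tendsto (fun i => ∫⁻ w, ENNReal.ofReal (g.pathRatio k x (n i) w) ∂μ) atTop
        (𝓝 (∫⁻ w, U w ∂μ)) := by
      refine tendsto_lintegral_of_dominated_convergence (fun _ => ENNReal.ofReal M)
        (fun i => (g.measurable_pathRatio k x (n i)).ennreal_ofReal)
        (fun i => ae_of_all _ fun w => ENNReal.ofReal_le_ofReal ((le_abs_self _).trans (hb _ w)))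
        (by simp) ?_
      filter_upwards [hlim, hUv] with w hw hw'
      rw [hw']
      exact (ENNReal.continuous_ofReal.tendsto _).comp hw
    simp only [hmean] at h1
    exact tendsto_nhds_unique h1 tendsto_const_nhds
  have hone : ∫⁻ _, (1 : ℝ≥0∞) ∂μ = 1 := by simp
  have hU1 : ∀ᵐ w ∂μ, U w = 1 := by
    have hlt : μ {w | U w < 1} = 0 := by
      refine (hg _ (hUm measurableSet_Iio)).resolve_right fun h => ?_
      have hae : ∀ᵐ w ∂μ, U w < 1 := (prob_compl_eq_zero_iff (hUmeas measurableSet_Iio)).2 h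
      have := lintegral_strict_mono (IsProbabilityMeasure.ne_zero μ) aemeasurable_const
        (by rw [hUint]; simp) hae
      rw [hUint, hone] at this
      exact lt_irrefl _ this
    have hgt : μ {w | 1 < U w} = 0 := by
      refine (hg _ (hUm measurableSet_Ioi)).resolve_right fun h => ?_
      have hae : ∀ᵐ w ∂μ, 1 < U w := (prob_compl_eq_zero_iff (hUmeas measurableSet_Ioi)).2 h
      have := lintegral_strict_mono (IsProbabilityMeasure.ne_zero μ) hUmeas.aemeasurable
        (by rw [hone]; simp) hae
      rw [hUint, hone] at this
      exact lt_irrefl _ this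
    have h1 : ∀ᵐ w ∂μ, ¬ U w < 1 := measure_eq_zero_iff_ae_notMem.1 hlt
    have h2 : ∀ᵐ w ∂μ, ¬ 1 < U w := measure_eq_zero_iff_ae_notMem.1 hgt
    filter_upwards [h1, h2] with w h1 h2
    exact le_antisymm (not_lt.1 h2) (not_lt.1 h1)
  have hlim1 : ∀ᵐ w ∂μ, Tendsto (fun i => g.pathRatio k x (n i) w) atTop (𝓝 1) := by
    filter_upwards [hlim, hUv, hU1] with w h1 h2 h3
    have : v w = 1 := by
      rw [h3] at h2
      exact ENNReal.ofReal_eq_one.1 h2.symm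
    rwa [this] at h1
  have hsq : Tendsto (fun i => g.ratioSq k x (n i)) atTop (𝓝 1) := by
    have h1 : Tendsto (fun i => ∫ w, g.pathRatio k x (n i) w * g.pathRatio k x (n i) w ∂μ) atTop
        (𝓝 (∫ _, (1 : ℝ) ∂μ)) := by
      refine tendsto_integral_of_dominated_convergence (fun _ => M * M)
        (fun i => ((g.measurable_pathRatio k x (n i)).mul
          (g.measurable_pathRatio k x (n i))).aestronglyMeasurable)
        (integrable_const _) (fun i => ae_of_all _ fun w => ?_) ?_
      · rw [norm_mul]
        exact mul_le_mul (hb _ w) (hb _ w) (norm_nonneg _) ((abs_nonneg _).trans (hb 0 w))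
      · filter_upwards [hlim1] with w hw
        simpa using hw.mul hw
    have h2 : ∀ i, ∫ w, g.pathRatio k x (n i) w * g.pathRatio k x (n i) w ∂μ =
        g.ratioSq k x (n i) := fun i => g.integral_ratio_mul hx (n i) 0
    simpa [h2] using h1
  have hsub : Tendsto (fun i => g.condDiv k (n i) x) atTop (𝓝 0) :=
    squeeze_zero (fun i => g.condDiv_nonneg ..) (fun i => g.condDiv_le_ratioSq_sub_one hx (n i))
      (by simpa using hsq.sub_const 1)
  exact (tendsto_iff_tendsto_subseq_of_antitone (g.antitone_condDiv k hx) hn.tendsto_atTop).2 hsub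

/-! ### The Liouville property -/

lemma exists_mem_reach (x : g.V) : ∃ k, x ∈ g.reach k g.root := by
  obtain ⟨p⟩ := g.connected.preconnected g.root x
  classical
  suffices h : ∀ {u v : g.V}, g.graph.Walk u v → ∃ k, v ∈ g.reach k u from h p
  intro u v p
  induction p with
  | nil => exact ⟨0, by simp [reach]⟩
  | @cons u v w h _ ih =>
    obtain ⟨k, hk⟩ := ih
    have hv : v ∈ g.nbrs u := by simpa [nbrs] using h
    have hs : v ∈ g.succs u := by
      rw [succs, if_pos ⟨v, hv⟩]
      exact hv
    exact ⟨k + 1, by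
      rw [reach, Finset.mem_biUnion]
      exact ⟨v, hs, hk⟩⟩

lemma Harmonic.avg_eq {g : RootedGraph} {f : g.V → ℝ} (hf : g.Harmonic f) : g.avg f = f := by
  classical
  funext x
  by_cases h : (g.nbrs x).Nonempty
  · rw [avg, succs, if_pos h, hf x, deg]
  · rw [avg, succs, if_neg h]
    simp

/-- The value at `x` of a bounded harmonic function is its mean under the law of the walk from
`x` at a late time, and if the tail is trivial then this law is close in total variation to that
for the walk from the root. -/
theorem liouville_of_tailTrivial (hg : g.TailTrivial) : g.Liouville := by
  rintro f hf ⟨C, hC⟩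
  suffices h : ∀ x, f x = f g.root from fun x y => (h x).trans (h y).symm
  intro x
  obtain ⟨k, hx⟩ := g.exists_mem_reach x
  have hit : ∀ n, g.avg^[n] f = f := fun n => Function.iterate_fixed hf.avg_eq n
  have hb : ∀ m, |f x - f g.root| ≤
      C * ∑ y ∈ g.reach (k + m) g.root, |g.tp m x y - g.tp (k + m) g.root y| := by
    intro m
    have := g.abs_iterate_avg_sub_le k m hx hC
    rwa [hit, hit] at this
  have ht := (g.tendsto_totalVariation hx (g.tendsto_condDiv_of_tailTrivial hg hx)).const_mul C
  rw [mul_zero] at ht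
  exact sub_eq_zero.1 (abs_nonpos_iff.1 (ge_of_tendsto' ht hb))

end RootedGraph

end StatGraph


namespace StatGraph

namespace RootedGraph

/-! ### Local functions of a rooted graph -/

/-- `ι` maps `g` into `h` and preserves the root, and it maps the vertices reachable from `x` in one
step onto those reachable from `ι x`, for every `x` that the walk from the root of `g` can visit
before time `R`. -/
structure IsBallEmb (R : ℕ) (g h : RootedGraph) (ι : g.V ↪ h.V) : Prop where
  map_root : ι g.root = h.root
  succs_eq : ∀ j < R, ∀ x ∈ g.reach j g.root, h.succs (ι x) = (g.succs x).map ι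

lemma mem_reach_one (g : RootedGraph) {x y : g.V} : y ∈ g.reach 1 x ↔ y ∈ g.succs x := by
  classical
  simp [reach]

lemma succs_eq_map {g h : RootedGraph} {ι : g.V ↪ h.V} {x : g.V}
    (hx : h.nbrs (ι x) = (g.nbrs x).map ι) : h.succs (ι x) = (g.succs x).map ι := by
  classical
  unfold succs
  rw [hx]
  split_ifs with h1 h2 h2
  · rfl
  · exact absurd (Finset.map_nonempty.1 h1) h2
  · exact absurd (Finset.map_nonempty.2 h2) h1
  · rw [Finset.map_singleton]

lemma root_mem_reach_zero (g : RootedGraph) : g.root ∈ g.reach 0 g.root := by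
  simp [reach]

lemma reach_reroot (g : RootedGraph) (x : g.V) (n : ℕ) (y : g.V) :
    (g.reroot x).reach n y = g.reach n y := by
  classical
  induction n generalizing y with
  | zero => rfl
  | succ n ih => exact Finset.biUnion_congr rfl fun z _ => ih z

lemma posEntropy_reroot (g : RootedGraph) (x : g.V) (n : ℕ) (y : g.V) :
    (g.reroot x).posEntropy n y = g.posEntropy n y :=
  Finset.sum_congr (g.reach_reroot x n y) fun _ _ => rfl

namespace IsBallEmb

variable {R : ℕ} {g h : RootedGraph} {ι : g.V ↪ h.V}

lemma mono {R' : ℕ} (H : IsBallEmb R g h ι) (hR : R' ≤ R) : IsBallEmb R' g h ι :=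
  ⟨H.map_root, fun j hj => H.succs_eq j (hj.trans_le hR)⟩

lemma reroot {n : ℕ} (H : IsBallEmb (n + R) g h ι) {x : g.V} (hx : x ∈ g.reach n g.root) :
    IsBallEmb R (g.reroot x) (h.reroot (ι x)) ι :=
  ⟨rfl, fun j hj y hy => by
    have hy' : y ∈ g.reach j x := by
      rw [← g.reach_reroot x]
      exact hy
    exact H.succs_eq (n + j) (by omega) y (g.mem_reach_add hx hy')⟩

lemma iterate_avg (H : IsBallEmb R g h ι) (f : h.V → ℝ) {i j : ℕ} (hij : i + j ≤ R) {x : g.V}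
    (hx : x ∈ g.reach i g.root) : h.avg^[j] f (ι x) = g.avg^[j] (f ∘ ι) x := by
  induction j generalizing i x with
  | zero => rfl
  | succ j ih =>
    rw [Function.iterate_succ_apply', Function.iterate_succ_apply', avg, avg,
      H.succs_eq i (by omega) x hx, Finset.sum_map, Finset.card_map]
    congr 1
    exact Finset.sum_congr rfl fun z hz =>
      ih (i := i + 1) (by omega) (g.mem_reach_add hx (g.mem_reach_one.2 hz))

lemma reach_eq (H : IsBallEmb R g h ι) {i j : ℕ} (hij : i + j ≤ R) {x : g.V}
    (hx : x ∈ g.reach i g.root) : h.reach j (ι x) = (g.reach j x).map ι := by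
  classical
  induction j generalizing i x with
  | zero => simp [reach]
  | succ j ih =>
    ext y
    rw [reach, Finset.mem_biUnion, H.succs_eq i (by omega) x hx, reach]
    simp only [Finset.mem_map, Finset.mem_biUnion]
    constructor
    · rintro ⟨_, ⟨z, hz, rfl⟩, hy⟩
      rw [ih (i := i + 1) (by omega) (g.mem_reach_add hx (g.mem_reach_one.2 hz)),
        Finset.mem_map] at hy
      obtain ⟨y, hy, rfl⟩ := hy
      exact ⟨y, ⟨z, hz, hy⟩, rfl⟩
    · rintro ⟨y, ⟨z, hz, hy⟩, rfl⟩
      refine ⟨ι z, ⟨z, hz, rfl⟩, ?_⟩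
      rw [ih (i := i + 1) (by omega) (g.mem_reach_add hx (g.mem_reach_one.2 hz))]
      exact Finset.mem_map_of_mem ι hy

lemma tp_eq (H : IsBallEmb R g h ι) {n : ℕ} (hn : n ≤ R) (y : g.V) :
    h.tp n h.root (ι y) = g.tp n g.root y := by
  rw [tp, ← H.map_root, H.iterate_avg _ (i := 0) (by omega) g.root_mem_reach_zero, tp]
  refine congrFun (congrArg _ (funext fun z => ?_)) g.root
  by_cases hz : z = y
  · simp [hz]
  · have hz' : ι z ≠ ι y := fun h => hz (ι.injective h)
    rw [Function.comp_apply, Set.indicator_of_notMem (by simpa using hz'),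
      Set.indicator_of_notMem (by simpa using hz)]

lemma reach_root_eq (H : IsBallEmb R g h ι) {n : ℕ} (hn : n ≤ R) :
    h.reach n h.root = (g.reach n g.root).map ι := by
  rw [← H.map_root, H.reach_eq (i := 0) (by omega) g.root_mem_reach_zero]

end IsBallEmb

/-- A function of a rooted graph is local if it is determined by the ball of some fixed radius
around the root. -/
def IsLocal {α : Type*} (F : RootedGraph → α) : Prop :=
  ∃ R : ℕ, ∀ (g h : RootedGraph) (ι : g.V ↪ h.V), IsBallEmb R g h ι → F g = F h

lemma IsLocal.comp {α β : Type*} {F : RootedGraph → α} (hF : IsLocal F) (u : α → β) :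
    IsLocal fun g => u (F g) := by
  obtain ⟨R, hR⟩ := hF
  exact ⟨R, fun g h ι H => congrArg u (hR g h ι H)⟩

lemma IsLocal.comp₂ {α β γ : Type*} {F : RootedGraph → α} {F' : RootedGraph → β}
    (hF : IsLocal F) (hF' : IsLocal F') (u : α → β → γ) : IsLocal fun g => u (F g) (F' g) := by
  obtain ⟨R, hR⟩ := hF
  obtain ⟨R', hR'⟩ := hF'
  exact ⟨max R R', fun g h ι H => congrArg₂ u (hR g h ι (H.mono (le_max_left _ _)))
    (hR' g h ι (H.mono (le_max_right _ _)))⟩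

lemma isLocal_posEntropy (n : ℕ) : IsLocal fun g => g.posEntropy n g.root := by
  refine ⟨n, fun g h ι H => ?_⟩
  simp only [posEntropy]
  rw [H.reach_root_eq le_rfl, Finset.sum_map]
  exact Finset.sum_congr rfl fun y _ => by rw [H.tp_eq le_rfl]

/-- Averaging a local function over the position of the walk at time `n` gives a local function. -/
lemma IsLocal.sum_reach {α β : Type*} [AddCommMonoid β] {F : RootedGraph → α} (hF : IsLocal F)
    (n : ℕ) (u : ℝ → α → β) :
    IsLocal fun g => ∑ x ∈ g.reach n g.root, u (g.tp n g.root x) (F (g.reroot x)) := by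
  obtain ⟨R, hR⟩ := hF
  refine ⟨n + R, fun g h ι H => ?_⟩
  beta_reduce
  rw [H.reach_root_eq (by omega), Finset.sum_map]
  refine Finset.sum_congr rfl fun x hx => ?_
  have := hR (g.reroot x) (h.reroot (ι x)) ι (H.reroot hx)
  rw [H.tp_eq (by omega), this]

lemma isLocal_mutualInfo (k m : ℕ) : IsLocal fun g => g.mutualInfo k m := by
  have h1 := (isLocal_posEntropy m).sum_reach k fun a b => a * b
  have h2 := (isLocal_posEntropy (k + m)).comp₂ h1 fun a b => a - b
  have e : (fun g : RootedGraph => g.mutualInfo k m) = fun g => g.posEntropy (k + m) g.root -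
      ∑ x ∈ g.reach k g.root, g.tp k g.root x * (g.reroot x).posEntropy m (g.reroot x).root := by
    funext g
    rw [mutualInfo, iterate_avg_eq_sum]
    congr 1
    exact Finset.sum_congr rfl fun x _ => 
      congrArg (g.tp k g.root x * ·) (g.posEntropy_reroot x m x).symm
  rw [e]
  exact h2

/-! ### Local functions are measurable -/

lemma isBallEmb_of_iso {g h : RootedGraph} (e : g.graph ≃g h.graph) (he : e g.root = h.root)
    (R : ℕ) : IsBallEmb R g h e.toEquiv.toEmbedding := by
  refine ⟨he, fun _ _ x _ => succs_eq_map ?_⟩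
  ext y
  simp only [nbrs, Set.Finite.mem_toFinset, SimpleGraph.mem_neighborSet, Finset.mem_map]
  constructor
  · intro hy
    refine ⟨e.symm y, ?_, e.apply_symm_apply y⟩
    rw [← e.map_adj_iff, e.apply_symm_apply]
    exact hy
  · rintro ⟨z, hz, rfl⟩
    exact e.map_adj_iff.2 hz

lemma dist_le_of_mem_ballSet (g : RootedGraph) {r : ℕ} {x : g.V} (hx : x ∈ g.ballSet r) :
    g.graph.dist g.root x ≤ r := hx

lemma induce_ballSet_connected (g : RootedGraph) (r : ℕ) :
    (g.graph.induce (g.ballSet r)).Connected := by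
  classical
  have h : ∀ x : g.ballSet r,
      (g.graph.induce (g.ballSet r)).Reachable ⟨g.root, g.root_mem_ballSet r⟩ x := by
    rintro ⟨x, hx⟩
    obtain ⟨p, hp⟩ := g.connected.exists_walk_length_eq_dist g.root x
    have hs : ∀ y ∈ p.support, y ∈ g.ballSet r := fun y hy =>
      ((SimpleGraph.dist_le (p.takeUntil y hy)).trans (p.length_takeUntil_le_length hy)).trans
        (hp.le.trans (g.dist_le_of_mem_ballSet hx))
    exact ⟨p.induce (g.ballSet r) hs⟩
  have : Nonempty (g.ballSet r) := ⟨⟨g.root, g.root_mem_ballSet r⟩⟩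
  exact ⟨fun x y => (h x).symm.trans (h y)⟩

/-- The ball of radius `r` around the root, as a rooted graph. -/
def ball (g : RootedGraph) (r : ℕ) : RootedGraph where
  V := g.ballSet r
  graph := g.graph.induce (g.ballSet r)
  root := ⟨g.root, g.root_mem_ballSet r⟩
  countable := inferInstance
  connected := g.induce_ballSet_connected r
  finite_neighborSet x := by
    refine Set.Finite.of_finite_image (f := Subtype.val) ?_ Subtype.val_injective.injOn
    refine (g.finite_neighborSet x.1).subset ?_
    rintro _ ⟨y, hy, rfl⟩
    exact hy

lemma dist_le_of_mem_reach_ball (g : RootedGraph) (r : ℕ) {j : ℕ} {x y : (g.ball r).V}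
    (hy : y ∈ (g.ball r).reach j x) : g.graph.dist x.1 y.1 ≤ j := by
  classical
  induction j generalizing x with
  | zero =>
    have : y = x := by simpa [reach] using hy
    simp [this]
  | succ j ih =>
    rw [reach, Finset.mem_biUnion] at hy
    obtain ⟨z, hz, hy⟩ := hy
    have h1 : g.graph.dist x.1 z.1 ≤ 1 := by
      unfold succs at hz
      split_ifs at hz with h
      · have hz' : g.graph.Adj x.1 z.1 := by
          have : (g.ball r).graph.Adj x z := by simpa [nbrs] using hz
          exact this
        exact (SimpleGraph.dist_eq_one_iff_adj.2 hz').le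
      · rw [Finset.mem_singleton.1 hz]
        simp
    have := ih hy
    have := g.connected.dist_triangle (u := x.1) (v := z.1) (w := y.1)
    omega

/-- The inclusion of a ball. -/
def ballEmb (g : RootedGraph) (r : ℕ) : (g.ball r).V ↪ g.V :=
  Function.Embedding.subtype fun x => x ∈ g.ballSet r

lemma isBallEmb_ball (g : RootedGraph) (r : ℕ) : IsBallEmb r (g.ball r) g (g.ballEmb r) := by
  refine ⟨rfl, fun j hj x hx => succs_eq_map (ι := g.ballEmb r) (x := x) ?_⟩
  have hd : g.graph.dist g.root x.1 ≤ j := g.dist_le_of_mem_reach_ball r hx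
  ext y
  simp only [nbrs, Set.Finite.mem_toFinset, SimpleGraph.mem_neighborSet, Finset.mem_map]
  constructor
  · intro hy
    have h1 : g.graph.dist x.1 y = 1 := SimpleGraph.dist_eq_one_iff_adj.2 hy
    have h2 := g.connected.dist_triangle (u := g.root) (v := x.1) (w := y)
    exact ⟨⟨y, (by omega : g.graph.dist g.root y ≤ r)⟩, hy, rfl⟩
  · rintro ⟨z, hz, rfl⟩
    exact hz

lemma BallIso.refl (g : RootedGraph) (r : ℕ) : BallIso g g r := ⟨SimpleGraph.Iso.refl, rfl⟩

lemma ballIso_zero (g h : RootedGraph) : BallIso g h 0 := by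
  have hs : ∀ k : RootedGraph, Subsingleton (k.ballSet 0) := fun k =>
    ⟨fun x y => by
      have hr : ∀ z : k.ballSet 0, k.root = z.1 := fun z =>
        (k.connected.dist_eq_zero_iff).1 (Nat.le_zero.1 (k.dist_le_of_mem_ballSet z.2))
      exact Subtype.ext ((hr x).symm.trans (hr y))⟩
  have := hs g
  have := hs h
  refine ⟨⟨⟨fun _ => ⟨h.root, h.root_mem_ballSet 0⟩, fun _ => ⟨g.root, g.root_mem_ballSet 0⟩,
    fun _ => Subsingleton.elim _ _, fun _ => Subsingleton.elim _ _⟩, fun {a b} => ?_⟩, rfl⟩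
  obtain rfl := Subsingleton.elim a b
  exact iff_of_false (SimpleGraph.irrefl _) (SimpleGraph.irrefl _)

lemma IsLocal.eq_of_iso {α : Type*} {F : RootedGraph → α} (hF : IsLocal F) {g h : RootedGraph}
    (H : Iso g h) : F g = F h := by
  obtain ⟨R, hR⟩ := hF
  obtain ⟨e, he⟩ := H
  exact hR g h _ (isBallEmb_of_iso e he R)

lemma IsLocal.rep_mk {α : Type*} {F : RootedGraph → α} (hF : IsLocal F) (g : RootedGraph) :
    F (RootedGraphClass.rep ⟦g⟧) = F g :=
  hF.eq_of_iso (Quotient.mk_out g)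

lemma IsLocal.isOpen_preimage {α : Type*} {F : RootedGraph → α} (hF : IsLocal F) (S : Set α) :
    IsOpen {c : RootedGraphClass | F c.rep ∈ S} := by
  obtain ⟨R, hR⟩ := id hF
  refine isOpen_iff_forall_mem_open.2 fun c hc => ?_
  have hR0 : (0 : ℝ) < 1 / ((R : ℝ) + 1) := by positivity
  refine ⟨{d | RootedGraphClass.dloc c d < 1 / ((R : ℝ) + 1)}, ?_,
    TopologicalSpace.isOpen_generateFrom_of_mem ⟨c, _, hR0, rfl⟩, ?_⟩
  · intro d hd
    obtain ⟨_, ⟨r, rfl, hr⟩, hlt⟩ := exists_lt_of_csInf_lt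
      (⟨_, 0, rfl, ballIso_zero c.rep d.rep⟩ : {t : ℝ | ∃ r : ℕ, t = 1 / ((r : ℝ) + 1) ∧
        c.rep.BallIso d.rep r}.Nonempty) hd
    have hRr : R ≤ r := by
      have := (one_div_lt_one_div (by positivity) (by positivity)).1 hlt
      have : R < r := by exact_mod_cast (add_lt_add_iff_right 1).1 this
      exact this.le
    have h1 := hR _ _ _ ((c.rep.isBallEmb_ball r).mono hRr)
    have h2 := hR _ _ _ ((d.rep.isBallEmb_ball r).mono hRr)
    have h3 : F (c.rep.ball r) = F (d.rep.ball r) := hF.eq_of_iso hr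
    have : F d.rep = F c.rep := by rw [← h2, ← h3, h1]
    exact (congrArg (· ∈ S) this).mpr hc
  -- The radius `R + 1` gives strict inequality.
  · refine (csInf_le ?_ ⟨R + 1, rfl, BallIso.refl c.rep (R + 1)⟩ :
      RootedGraphClass.dloc c c ≤ _).trans_lt ?_
    · refine ⟨0, ?_⟩
      rintro _ ⟨r, rfl, _⟩
      positivity
    · push_cast
      exact one_div_lt_one_div_of_lt (by positivity) (by linarith)

lemma IsLocal.measurable {α : Type*} [MeasurableSpace α] {F : RootedGraph → α} (hF : IsLocal F) :
    Measurable fun c : RootedGraphClass => F c.rep :=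
  fun S _ => (hF.isOpen_preimage S).measurableSet

/-! ### Stationarity for local functions -/

lemma walkLaw_eval_mem (g : RootedGraph) (n : ℕ) (T : Set g.V) :
    g.walkLaw {w | w n ∈ T} =
      ∑ x ∈ g.reach n g.root, ENNReal.ofReal (g.tp n g.root x) * T.indicator 1 x := by
  classical
  have hm : MeasurableSet {w : ℕ → g.V | w 0 ∈ T} :=
    (measurable_pi_apply 0 : Measurable fun w : ℕ → g.V => w 0) (MeasurableSet.of_discrete (s := T))
  have h0 : ∀ y, (g.walkFrom y).real {w | w 0 ∈ T} = T.indicator 1 y := by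
    intro y
    have : {w : ℕ → g.V | w 0 ∈ T} =ᵐ[g.walkFrom y] {_w | y ∈ T} := by
      refine eventuallyEq_set.2 ?_
      filter_upwards [g.ae_walkFrom_zero y] with w hw
      exact (congrArg (· ∈ T) hw).to_iff
    rw [measureReal_congr this]
    by_cases hy : y ∈ T <;> simp [hy]
  have h1 : {w : ℕ → g.V | w n ∈ T} = shift n ⁻¹' {w | w 0 ∈ T} := by
    ext w
    simp [shift]
  rw [walkLaw_eq, ← ofReal_measureReal, h1, walkFrom_real_shift g n _ hm, iterate_avg_eq_sum,
    ENNReal.ofReal_sum_of_nonneg fun _ _ => mul_nonneg (g.tp_nonneg ..) measureReal_nonneg]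
  refine Finset.sum_congr rfl fun x _ => ?_
  rw [h0, ENNReal.ofReal_mul (g.tp_nonneg ..)]
  by_cases hx : x ∈ T <;> simp [hx]

/-- In a stationary random graph, a local function has the same mean when seen from the position
of the walk at time `n` as when seen from the root. -/
theorem lintegral_sum_reach {P : Measure RootedGraphClass} (hP : Stationary P)
    {F : RootedGraph → ℝ≥0∞} (hF : IsLocal F) (n : ℕ) :
    ∫⁻ c, ∑ x ∈ c.rep.reach n c.rep.root,
      ENNReal.ofReal (c.rep.tp n c.rep.root x) * F (c.rep.reroot x) ∂P = ∫⁻ c, F c.rep ∂P := by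
  rcases Nat.eq_zero_or_pos n with rfl | hn
  · refine lintegral_congr fun c => ?_
    rw [show c.rep.reach 0 c.rep.root = {c.rep.root} from rfl, Finset.sum_singleton, tp_zero]
    simp
    rfl
  have hmeas : ∀ u : ℝ≥0∞ → ℝ≥0∞, Measurable fun c : RootedGraphClass =>
      ∑ x ∈ c.rep.reach n c.rep.root,
        ENNReal.ofReal (c.rep.tp n c.rep.root x) * u (F (c.rep.reroot x)) := fun u =>
    (hF.sum_reach n fun a b => ENNReal.ofReal a * u b).measurable
  -- Stationarity is the case where `u` is an indicator: it is about events, and `{F ∈ S}` is one.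
  have key : ∀ u : ℝ≥0∞ → ℝ≥0∞, Measurable u →
      ∫⁻ c, ∑ x ∈ c.rep.reach n c.rep.root,
        ENNReal.ofReal (c.rep.tp n c.rep.root x) * u (F (c.rep.reroot x)) ∂P =
      ∫⁻ c, u (F c.rep) ∂P := by
    intro u hu
    refine Measurable.ennreal_induction (motive := fun u =>
      ∫⁻ c, ∑ x ∈ c.rep.reach n c.rep.root,
        ENNReal.ofReal (c.rep.tp n c.rep.root x) * u (F (c.rep.reroot x)) ∂P =
      ∫⁻ c, u (F c.rep) ∂P) ?_ ?_ ?_ hu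
    · intro a S hS
      have hA : MeasurableSet {c : RootedGraphClass | F c.rep ∈ S} :=
        (hF.isOpen_preimage S).measurableSet
      have h1 : ∀ (a : ℝ≥0∞) (c : RootedGraphClass), ∑ x ∈ c.rep.reach n c.rep.root,
          ENNReal.ofReal (c.rep.tp n c.rep.root x) *
            S.indicator (fun _ => a) (F (c.rep.reroot x)) =
          a * c.rep.walkLaw {w | (⟦c.rep.reroot (w n)⟧ : RootedGraphClass) ∈
            {c : RootedGraphClass | F c.rep ∈ S}} := by
        intro a c
        have : {w : ℕ → c.rep.V | (⟦c.rep.reroot (w n)⟧ : RootedGraphClass) ∈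
            {c : RootedGraphClass | F c.rep ∈ S}} =
            {w | w n ∈ {x | F (c.rep.reroot x) ∈ S}} := by
          ext w
          exact (congrArg (· ∈ S) (hF.rep_mk (c.rep.reroot (w n)))).to_iff
        rw [this, walkLaw_eval_mem, Finset.mul_sum]
        refine Finset.sum_congr rfl fun x _ => ?_
        by_cases hx : F (c.rep.reroot x) ∈ S <;> simp [hx, mul_comm]
      have hm := hmeas (S.indicator fun _ => 1)
      simp only [h1, one_mul] at hm
      have h2 : ∀ c : RootedGraphClass, S.indicator (fun _ => a) (F c.rep) =
          {c : RootedGraphClass | F c.rep ∈ S}.indicator (fun _ => a) c := fun c => rfl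
      simp only [h1, h2]
      rw [lintegral_const_mul _ hm, hP n hn _ hA, lintegral_indicator_const hA]
    · intro f f' _ hf _ h h'
      simp only [Pi.add_apply, mul_add, Finset.sum_add_distrib]
      rw [lintegral_add_left (hmeas f), h, h']
      exact (lintegral_add_left (hf.comp hF.measurable) _).symm
    · intro f hf hmono h
      have e : ∀ c : RootedGraphClass, ∑ x ∈ c.rep.reach n c.rep.root,
          ENNReal.ofReal (c.rep.tp n c.rep.root x) * ⨆ i, f i (F (c.rep.reroot x)) =
          ⨆ i, ∑ x ∈ c.rep.reach n c.rep.root,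
            ENNReal.ofReal (c.rep.tp n c.rep.root x) * f i (F (c.rep.reroot x)) := by
        intro c
        simp only [ENNReal.mul_iSup]
        exact ENNReal.finsetSum_iSup_of_monotone fun x i j hij =>
          mul_le_mul_right (hmono hij _) _
      simp only [e]
      rw [lintegral_iSup (fun i => hmeas (f i)) fun i j hij c =>
          Finset.sum_le_sum fun x _ => mul_le_mul_right (hmono hij _) _]
      exact (iSup_congr h).trans (lintegral_iSup (fun i => (hf i).comp hF.measurable)
        fun i j hij c => hmono hij _).symm
  exact key id measurable_id

end RootedGraph

end StatGraph


namespace StatGraph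

/-! ### Mean entropy -/

/-- The mean of the mutual information of `X k` and `X (k + m)`. -/
def meanInfo (P : Measure RootedGraphClass) (k m : ℕ) : ℝ≥0∞ :=
  ∫⁻ c, ENNReal.ofReal (c.rep.mutualInfo k m) ∂P

lemma measurable_mutualInfo (k m : ℕ) :
    Measurable fun c : RootedGraphClass => ENNReal.ofReal (c.rep.mutualInfo k m) :=
  ((RootedGraph.isLocal_mutualInfo k m).comp ENNReal.ofReal).measurable

lemma antitone_meanInfo (P : Measure RootedGraphClass) (k : ℕ) : Antitone (meanInfo P k) :=
  fun _ _ h => lintegral_mono fun c =>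
    ENNReal.ofReal_le_ofReal (c.rep.antitone_mutualInfo k h)

/-- The chain rule for entropy: by stationarity the mean conditional entropy of `X (k + m)` given
`X k` is the mean entropy at time `m`. -/
lemma meanEntropyAt_add {P : Measure RootedGraphClass} (hP : Stationary P) (k m : ℕ) :
    meanEntropyAt P (k + m) = meanEntropyAt P m + meanInfo P k m := by
  have hF := (RootedGraph.isLocal_posEntropy m).comp ENNReal.ofReal
  have h1 : ∀ c : RootedGraphClass, c.rep.entropy (k + m) =
      (∑ x ∈ c.rep.reach k c.rep.root, ENNReal.ofReal (c.rep.tp k c.rep.root x) *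
        ENNReal.ofReal ((c.rep.reroot x).posEntropy m (c.rep.reroot x).root)) +
      ENNReal.ofReal (c.rep.mutualInfo k m) := by
    intro c
    have hnn : 0 ≤ c.rep.avg^[k] (c.rep.posEntropy m) c.rep.root :=
      c.rep.iterate_avg_nonneg k (fun x => c.rep.posEntropy_nonneg m x) c.rep.root
    have h2 : ENNReal.ofReal (c.rep.avg^[k] (c.rep.posEntropy m) c.rep.root) =
        ∑ x ∈ c.rep.reach k c.rep.root, ENNReal.ofReal (c.rep.tp k c.rep.root x) *
          ENNReal.ofReal ((c.rep.reroot x).posEntropy m (c.rep.reroot x).root) := by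
      rw [RootedGraph.iterate_avg_eq_sum, ENNReal.ofReal_sum_of_nonneg fun _ _ =>
        mul_nonneg (c.rep.tp_nonneg ..) (c.rep.posEntropy_nonneg ..)]
      refine Finset.sum_congr rfl fun x _ => ?_
      rw [ENNReal.ofReal_mul (c.rep.tp_nonneg ..)]
      exact congrArg (fun t => ENNReal.ofReal (c.rep.tp k c.rep.root x) * ENNReal.ofReal t)
        (c.rep.posEntropy_reroot x m x).symm
    rw [← h2, ← ENNReal.ofReal_add hnn (c.rep.mutualInfo_nonneg k m), RootedGraph.entropy_eq,
      RootedGraph.mutualInfo, add_sub_cancel]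
  rw [meanEntropyAt, lintegral_congr h1, lintegral_add_right _ (measurable_mutualInfo k m),
    RootedGraph.lintegral_sum_reach hP hF k, meanEntropyAt, meanInfo]
  simp only [RootedGraph.entropy_eq]

lemma meanEntropyAt_zero (P : Measure RootedGraphClass) : meanEntropyAt P 0 = 0 := by
  have : ∀ c : RootedGraphClass, c.rep.entropy 0 = 0 := fun c => by
    rw [RootedGraph.entropy_eq, RootedGraph.posEntropy,
      show c.rep.reach 0 c.rep.root = {c.rep.root} from rfl, Finset.sum_singleton,
      RootedGraph.tp_zero]
    simp
  simp [meanEntropyAt, this]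

/-- Since the mean entropies increase, they are all finite if `h < ∞`. -/
lemma meanEntropyAt_ne_top {P : Measure RootedGraphClass} (hP : Stationary P)
    (hfin : meanEntropy P ≠ ⊤) (m : ℕ) : meanEntropyAt P m ≠ ⊤ := by
  intro hm
  apply hfin
  have h : ∀ᶠ n : ℕ in atTop, meanEntropyAt P n / (n : ℝ≥0∞) = ⊤ := by
    filter_upwards [eventually_ge_atTop m] with n hn
    obtain ⟨k, rfl⟩ := Nat.exists_eq_add_of_le' hn
    rw [meanEntropyAt_add hP, hm, top_add]
    exact ENNReal.top_div_of_ne_top (ENNReal.natCast_ne_top _)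
  rw [meanEntropy, limsup_congr h, limsup_const]

/-- A sequence with decreasing increments grows linearly, at the rate given by their limit. -/
lemma tendsto_div_of_antitone_increments {a e : ℕ → ℝ≥0∞} (h0 : a 0 = 0)
    (ha : ∀ m, a (1 + m) = a m + e m) (he : Antitone e) (hfin : ∀ m, e m ≠ ⊤) :
    Tendsto (fun n : ℕ => a n / (n : ℝ≥0∞)) atTop (𝓝 (⨅ m, e m)) := by
  have hL : (⨅ m, e m) ≠ ⊤ := ne_top_of_le_ne_top (hfin 0) (iInf_le e 0)
  have h1 : Tendsto (fun m => (e m).toReal) atTop (𝓝 (⨅ m, e m).toReal) :=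
    (ENNReal.tendsto_toReal hL).comp (tendsto_atTop_iInf he)
  have h2 := (ENNReal.continuous_ofReal.tendsto _).comp h1.cesaro
  rw [ENNReal.ofReal_toReal hL] at h2
  refine h2.congr' ?_
  have hsum : ∀ n, a n = ∑ i ∈ Finset.range n, e i := by
    intro n
    induction n with
    | zero => simp [h0]
    | succ n ih => rw [Finset.sum_range_succ, ← ih, add_comm n 1, ha]
  filter_upwards [eventually_gt_atTop 0] with n hn
  have hn' : (0 : ℝ) < n := by exact_mod_cast hn
  rw [Function.comp_apply, ENNReal.ofReal_mul (by positivity), ENNReal.ofReal_inv_of_pos hn',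
    ENNReal.ofReal_natCast, ENNReal.ofReal_sum_of_nonneg fun _ _ => ENNReal.toReal_nonneg,
    hsum, ENNReal.div_eq_inv_mul]
  congr 1
  exact Finset.sum_congr rfl fun i _ => ENNReal.ofReal_toReal (hfin i)

section

variable {P : Measure RootedGraphClass}

lemma meanInfo_ne_top (hP : Stationary P) (hfin : meanEntropy P ≠ ⊤) (k m : ℕ) :
    meanInfo P k m ≠ ⊤ := by
  have := meanEntropyAt_ne_top hP hfin (k + m)
  rw [meanEntropyAt_add hP] at this
  exact (ENNReal.add_ne_top.1 this).2

lemma tendsto_meanEntropyAt_div (hP : Stationary P) (hfin : meanEntropy P ≠ ⊤) :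
    Tendsto (fun n : ℕ => meanEntropyAt P n / (n : ℝ≥0∞)) atTop (𝓝 (⨅ m, meanInfo P 1 m)) :=
  tendsto_div_of_antitone_increments (meanEntropyAt_zero P) (meanEntropyAt_add hP 1)
    (antitone_meanInfo P 1) (meanInfo_ne_top hP hfin 1)

lemma meanEntropy_eq_iInf (hP : Stationary P) (hfin : meanEntropy P ≠ ⊤) :
    meanEntropy P = ⨅ m, meanInfo P 1 m :=
  (tendsto_meanEntropyAt_div hP hfin).limsup_eq

/-- The mutual information of `X k` and `X (k + m)` is on average at most `k` times that of `X 1`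
and `X (1 + m)`. -/
lemma meanInfo_le (hP : Stationary P) (hfin : meanEntropy P ≠ ⊤) (k m : ℕ) :
    meanInfo P k m ≤ k * meanInfo P 1 m := by
  have h : meanEntropyAt P (k + m) ≤ meanEntropyAt P m + k * meanInfo P 1 m := by
    induction k with
    | zero => simp
    | succ k ih =>
      have e := meanEntropyAt_add hP 1 (k + m)
      rw [show k + 1 + m = 1 + (k + m) by ring, e, Nat.cast_add, Nat.cast_one, add_mul, one_mul,
        ← add_assoc]
      exact add_le_add ih (antitone_meanInfo P 1 (Nat.le_add_left m k))
  rw [meanEntropyAt_add hP] at h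
  exact (ENNReal.add_le_add_iff_left (meanEntropyAt_ne_top hP hfin m)).1 h

/-- If the tail is almost surely trivial, then the mutual information of `X 1` and `X (1 + m)`
decreases to `0` almost surely, hence in mean. -/
lemma meanEntropy_eq_zero (hP : Stationary P) (hfin : meanEntropy P ≠ ⊤)
    (h : ∀ᵐ c ∂P, c.rep.TailTrivial) : meanEntropy P = 0 := by
  have h1 : ∀ᵐ c ∂P, ⨅ m, ENNReal.ofReal (c.rep.mutualInfo 1 m) = 0 := by
    filter_upwards [h] with c hc
    have ht : Tendsto (fun m => c.rep.mutualInfo 1 m) atTop (𝓝 0) := by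
      simp only [RootedGraph.mutualInfo_eq_sum]
      have := tendsto_finsetSum (c.rep.reach 1 c.rep.root) fun x hx =>
        (c.rep.tendsto_condDiv_of_tailTrivial hc hx).const_mul (c.rep.tp 1 c.rep.root x)
      simpa using this
    have ht' := (ENNReal.continuous_ofReal.tendsto _).comp ht
    rw [ENNReal.ofReal_zero] at ht'
    have hanti : Antitone fun m => ENNReal.ofReal (c.rep.mutualInfo 1 m) := fun _ _ h =>
      ENNReal.ofReal_le_ofReal (c.rep.antitone_mutualInfo 1 h)
    exact tendsto_nhds_unique (tendsto_atTop_iInf hanti) ht'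
  rw [meanEntropy_eq_iInf hP hfin]
  have h2 := lintegral_iInf (μ := P) (fun m => measurable_mutualInfo 1 m)
    (fun _ _ h c => ENNReal.ofReal_le_ofReal (c.rep.antitone_mutualInfo 1 h))
    (meanInfo_ne_top hP hfin 1 0)
  rw [lintegral_congr_ae h1, lintegral_zero] at h2
  exact h2.symm

/-- If the mean entropy vanishes, then so does, almost surely, the limiting mutual information of
`X k` and `X (k + m)`, for every `k`. -/
lemma ae_tailTrivial (hP : Stationary P) (hfin : meanEntropy P ≠ ⊤) (h : meanEntropy P = 0) :
    ∀ᵐ c ∂P, c.rep.TailTrivial := by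
  rw [meanEntropy_eq_iInf hP hfin] at h
  have h1 : ∀ k, ∀ᵐ c ∂P, ⨅ m, ENNReal.ofReal (c.rep.mutualInfo k m) = 0 := by
    intro k
    refine (lintegral_eq_zero_iff (.iInf fun m => measurable_mutualInfo k m)).1 ?_
    refine le_antisymm (?_ : _ ≤ _) zero_le
    calc ∫⁻ c, ⨅ m, ENNReal.ofReal (c.rep.mutualInfo k m) ∂P
        ≤ ⨅ m, meanInfo P k m := le_iInf fun m => lintegral_mono fun c => iInf_le _ m
      _ ≤ ⨅ m, k * meanInfo P 1 m := iInf_mono fun m => meanInfo_le hP hfin k m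
      _ = k * ⨅ m, meanInfo P 1 m :=
          (ENNReal.mul_iInf' (fun hk => absurd hk (ENNReal.natCast_ne_top k))
            fun _ => inferInstance).symm
      _ = 0 := by rw [h, mul_zero]
  filter_upwards [ae_all_iff.2 h1] with c hc
  refine c.rep.tailTrivial_of_tendsto_condDiv fun k x hx => ?_
  have hanti : Antitone fun m => ENNReal.ofReal (c.rep.mutualInfo k m) := fun _ _ h =>
    ENNReal.ofReal_le_ofReal (c.rep.antitone_mutualInfo k h)
  have ht := tendsto_atTop_iInf hanti
  rw [hc k] at ht
  have ht' := (ENNReal.tendsto_toReal ENNReal.zero_ne_top).comp ht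
  have hx0 : 0 < c.rep.tp k c.rep.root x := c.rep.tp_pos_iff.2 hx
  refine squeeze_zero (fun m => c.rep.condDiv_nonneg k m x) (fun m => ?_)
    (by simpa using ht'.const_mul (c.rep.tp k c.rep.root x)⁻¹)
  rw [ENNReal.toReal_ofReal (c.rep.mutualInfo_nonneg k m),
    le_inv_mul_iff₀ hx0, RootedGraph.mutualInfo_eq_sum]
  exact Finset.single_le_sum (f := fun y => c.rep.tp k c.rep.root y * c.rep.condDiv k m y)
    (fun _ _ => mul_nonneg (c.rep.tp_nonneg ..) (c.rep.condDiv_nonneg ..)) hx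

end

end StatGraph

end

theorem theorem3p2
    (P : MeasureTheory.Measure StatGraph.RootedGraphClass)
    [MeasureTheory.IsProbabilityMeasure P]
    (hstat : StatGraph.Stationary P)
    (hfin : StatGraph.meanEntropy P ≠ ⊤) :
    Tendsto (fun n : ℕ => StatGraph.meanEntropyAt P n / (n : ℝ≥0∞)) atTop
        (𝓝 (StatGraph.meanEntropy P)) ∧
      ((∀ᵐ c ∂P, c.rep.TailTrivial) ↔ StatGraph.meanEntropy P = 0) ∧
      ((∀ᵐ c ∂P, c.rep.TailTrivial) → ∀ᵐ c ∂P, c.rep.Liouville) := by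
  refine ⟨?_, ⟨StatGraph.meanEntropy_eq_zero hstat hfin, StatGraph.ae_tailTrivial hstat hfin⟩,
    fun h => h.mono fun c hc => c.rep.liouville_of_tailTrivial hc⟩
  rw [StatGraph.meanEntropy_eq_iInf hstat hfin]
  exact StatGraph.tendsto_meanEntropyAt_div hstat hfin
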